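/- **Theorem (Scalar parameterization of conductivity in $\mathbb{R}^2$).** Let $\Omega\subset\mathbb{R}^2$ be a bounded convex open set and let $R=\begin{pmatrix}0&-1\\1&0\end{pmatrix}$ be the rotation matrix by the angle $\pi/2$. Let $\mathcal{M}_{\mathrm{div}}$ be the set of matrix fields $Q:\Omega\to\mathbb{R}^{2\times 2}$, modulo equality almost everywhere, such that $Q$ has entries in $L^1(\Omega)$; $Q(x)$ is symmetric and positive definite for almost every $x\in\Omega$; $Q$ is divergence-free, that is, $\int_\Omega(\nabla v)^T Q\,l\,dx=0$ for all $v\in C_0^\infty(\Omega)$ and all $l\in\mathbb{R}^2$; and $\det Q$ is uniformly bounded away from $0$ and $\infty$, that is, there are constants $0<c\le C$ with $c\le\det Q\le C$ almost everywhere in $\Omega$. Let $\mathcal{S}$ be the set of convex functions $s:\Omega\to\mathbb{R}$ of class $W^{2,1}(\Omega)$ for which the determinant of the (weak) Hessian is uniformly bounded away from $0$ and $\infty$, modulo the relation $s\sim s'$ if $s-s'$ is an affine function on $\Omega$. Then for each $Q\in\mathcal{M}_{\mathrm{div}}$ there exists a unique $s\in\mathcal{S}$ such that $$\operatorname{Hess}s=R^TQR,$$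 where $\operatorname{Hess} s$ is the weak Hessian of $s$, the equality holding almost everywhere in $\Omega$. Moreover, the map $\mathcal{M}_{\mathrm{div}}\to\mathcal{S}$ sending $Q$ to this $s$ is a bijection. -/

import Mathlib

open MeasureTheory
open scoped ContDiff Matrix

noncomputable section

/-- The Euclidean plane. -/
abbrev Plane : Type := EuclideanSpace ℝ (Fin 2)

/-- `2 × 2` real matrices. -/
abbrev Mat2 : Type := Matrix (Fin 2) (Fin 2) ℝ

/-- The rotation matrix by the angle `π / 2`. -/
def rotR : Mat2 := !![0, -1; 1, 0]

/-- Test functions on `Ω`: smooth functions with compact support contained in `Ω`. -/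
structure IsTestFunction (Ω : Set Plane) (φ : Plane → ℝ) : Prop where
  smooth : ContDiff ℝ ∞ φ
  hasCompactSupport : HasCompactSupport φ
  tsupport_subset : tsupport φ ⊆ Ω

/-- The classical partial derivative in the `i`-th coordinate direction. -/
def partialDeriv (i : Fin 2) (φ : Plane → ℝ) (x : Plane) : ℝ :=
  fderiv ℝ φ x (EuclideanSpace.single i 1)

/-- `v` is the weak `i`-th partial derivative of `u` on `Ω`. -/
structure HasWeakPartial (Ω : Set Plane) (i : Fin 2) (u v : Plane → ℝ) : Prop where
  locallyIntegrable_fun : LocallyIntegrableOn u Ω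
  locallyIntegrable_deriv : LocallyIntegrableOn v Ω
  integral_eq : ∀ φ : Plane → ℝ, IsTestFunction Ω φ →
    ∫ x in Ω, u x * partialDeriv i φ x = -∫ x in Ω, v x * φ x

/-- `g` is the weak gradient of `u` on `Ω`. -/
def HasWeakGradient (Ω : Set Plane) (u : Plane → ℝ) (g : Plane → Fin 2 → ℝ) : Prop :=
  ∀ i, HasWeakPartial Ω i u (fun x => g x i)

/-- `H` is the weak Hessian of `u` on `Ω`: the matrix of the weak partial derivatives of the
weak gradient of `u`. -/
def HasWeakHessian (Ω : Set Plane) (u : Plane → ℝ) (H : Plane → Mat2) : Prop :=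
  ∃ g : Plane → Fin 2 → ℝ, HasWeakGradient Ω u g ∧
    ∀ i, HasWeakGradient Ω (fun x => g x i) (fun x => H x i)

/-- Membership in the Sobolev space `W^{2,1}(Ω)`. -/
structure MemW21 (Ω : Set Plane) (u : Plane → ℝ) : Prop where
  integrable : IntegrableOn u Ω
  exists_gradient : ∃ g : Plane → Fin 2 → ℝ, HasWeakGradient Ω u g ∧
    ∀ i, IntegrableOn (fun x => g x i) Ω
  exists_hessian : ∃ H : Plane → Mat2, HasWeakHessian Ω u H ∧
    ∀ i j, IntegrableOn (fun x => H x i j) Ω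

/-- The determinant of the matrix field `M` is uniformly bounded away from `0` and `∞` on `Ω`
(the determinants are nonnegative for the fields to which this is applied). -/
def DetBounded (Ω : Set Plane) (M : Plane → Mat2) : Prop :=
  ∃ c C : ℝ, 0 < c ∧ ∀ᵐ x ∂volume.restrict Ω, c ≤ (M x).det ∧ (M x).det ≤ C

/-- The columns of `M` are weakly divergence-free vector fields on `Ω`:
`∫_Ω (∇v)ᵀ M l = 0` for all test functions `v` and all vectors `l`. -/
def IsDivergenceFree (Ω : Set Plane) (M : Plane → Mat2) : Prop :=
  ∀ v : Plane → ℝ, IsTestFunction Ω v → ∀ l : Fin 2 → ℝ,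
    ∫ x in Ω, (fun i => partialDeriv i v x) ⬝ᵥ (M x *ᵥ l) = 0

/-- The defining properties of divergence-free conductivities: `L¹` entries, symmetric and
positive definite almost everywhere (`Matrix.PosDef` includes symmetry), weakly divergence-free,
with determinant uniformly bounded away from `0` and `∞`. -/
structure IsDivFreeConductivity (Ω : Set Plane) (Q : Plane → Mat2) : Prop where
  integrable : ∀ i j, IntegrableOn (fun x => Q x i j) Ω
  posDef : ∀ᵐ x ∂volume.restrict Ω, (Q x).PosDef
  divergenceFree : IsDivergenceFree Ω Q
  detBounded : DetBounded Ω Q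

/-- Divergence-free conductivities on `Ω`, as functions. -/
abbrev DivFreeField (Ω : Set Plane) : Type := {Q : Plane → Mat2 // IsDivFreeConductivity Ω Q}

/-- Two matrix fields are identified if they agree almost everywhere on `Ω`. -/
instance divFreeSetoid (Ω : Set Plane) : Setoid (DivFreeField Ω) where
  r Q Q' := Q.1 =ᵐ[volume.restrict Ω] Q'.1
  iseqv := ⟨fun _ => Filter.EventuallyEq.rfl, fun h => h.symm, fun h h' => h.trans h'⟩

/-- The space `M_div` of divergence-free conductivities on `Ω`, modulo equality almost
everywhere. -/
abbrev MDiv (Ω : Set Plane) : Type := Quotient (divFreeSetoid Ω)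

/-- Convex functions on `Ω` of class `W^{2,1}(Ω)` for which the determinant of the Hessian is
uniformly bounded away from `0` and `∞`. -/
structure IsConvexPotential (Ω : Set Plane) (s : Plane → ℝ) : Prop where
  convexOn : ConvexOn ℝ Ω s
  memW21 : MemW21 Ω s
  detBounded : ∃ H : Plane → Mat2, HasWeakHessian Ω s H ∧ DetBounded Ω H

/-- The set of these convex functions, as functions. -/
abbrev ConvexPotential (Ω : Set Plane) : Type := {s : Plane → ℝ // IsConvexPotential Ω s}

/-- Two convex functions are identified if their difference is an affine function on `Ω`. -/
instance convexPotentialSetoid (Ω : Set Plane) : Setoid (ConvexPotential Ω) where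
  r s s' := ∃ a : Plane →ᵃ[ℝ] ℝ, ∀ x ∈ Ω, s.1 x - s'.1 x = a x
  iseqv :=
    { refl := fun s => ⟨0, fun x _ => by simp⟩
      symm := by
        rintro s s' ⟨a, ha⟩
        refine ⟨-a, fun x hx => ?_⟩
        have h := ha x hx
        simp only [AffineMap.coe_neg, Pi.neg_apply]
        linarith
      trans := by
        rintro s s' s'' ⟨a, ha⟩ ⟨b, hb⟩
        refine ⟨a + b, fun x hx => ?_⟩
        have h := ha x hx
        have h2 := hb x hx
        simp only [AffineMap.coe_add, Pi.add_apply]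
        linarith }

/-- The space `S` of convex functions modulo affine functions. -/
abbrev ConvexClass (Ω : Set Plane) : Type := Quotient (convexPotentialSetoid Ω)

end

/-!
In the plane, rotating by `R` exchanges divergence-free and curl-free fields: the rows of a
symmetric field `Q` are divergence-free exactly when the rows of `RᵀQR` are curl-free. The Poincaré
lemma, applied first to each row and then to the gradient so obtained (which is curl-free because
`RᵀQR` is symmetric), yields `s` with `Hess s = RᵀQR`.

For `L¹` fields the Poincaré lemma follows from the smooth one by mollification. The primitive is
averaged over starting points in a small ball, which makes it continuous in the `L¹` norm of the
field, and the mollified fields are curl-free away from the boundary of the domain.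

Conjugation by `R` preserves determinants and positive definiteness. Mollification also shows that
`s` agrees almost everywhere with a convex function when its weak Hessian is positive semidefinite,
and that conversely the Hessian of a convex function is positive semidefinite, hence positive
definite where its determinant is nonzero; so the construction can be reversed. Uniqueness holds
because a function with zero weak Hessian is affine.
-/

open Set Filter Metric
open scoped Topology Convolution ENNReal

section InnerPoints

variable {X : Type*} [PseudoMetricSpace X]

/-- The points of `Ω` whose closed `r`-ball stays in `Ω`. Mollifying with a kernel supported in the
`r`-ball does not see the boundary of `Ω` from these points. -/
def innerPoints (Ω : Set X) (r : ℝ) : Set X :=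
  {x | closedBall x r ⊆ Ω}

theorem innerPoints_subset (Ω : Set X) {r : ℝ} (hr : 0 ≤ r) : innerPoints Ω r ⊆ Ω :=
  fun _ hx => hx (mem_closedBall_self hr)

theorem innerPoints_antitone (Ω : Set X) : Antitone (innerPoints Ω) :=
  fun _ _ h _ hx => (closedBall_subset_closedBall h).trans hx

theorem exists_subset_innerPoints {Ω K : Set X} (hΩ : IsOpen Ω) (hK : IsCompact K) (hKΩ : K ⊆ Ω) :
    ∃ δ > 0, K ⊆ innerPoints Ω δ := by
  obtain ⟨δ, hδ, hδΩ⟩ := hK.exists_cthickening_subset_open hΩ hKΩ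
  exact ⟨δ, hδ, fun x hx => (closedBall_subset_cthickening hx δ).trans hδΩ⟩

variable {E : Type*} [SeminormedAddCommGroup E]

theorem mem_innerPoints_iff_forall_add {Ω : Set E} {r : ℝ} {x : E} :
    x ∈ innerPoints Ω r ↔ ∀ z ∈ closedBall (0 : E) r, z + x ∈ Ω := by
  refine ⟨fun hx z hz => hx ?_, fun h y hy => ?_⟩
  · simpa [mem_closedBall, dist_eq_norm] using hz
  · simpa using h (y - x) (by simpa [dist_eq_norm] using hy)

theorem isOpen_innerPoints [ProperSpace E] {Ω : Set E} (hΩ : IsOpen Ω) (r : ℝ) :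
    IsOpen (innerPoints Ω r) := by
  refine isOpen_iff_mem_nhds.2 fun x hx => ?_
  have hsum : Continuous fun p : E × E => p.2 + p.1 := by fun_prop
  have hev : ∀ᶠ y in 𝓝 x, ∀ z ∈ closedBall (0 : E) r, z + y ∈ Ω :=
    (isCompact_closedBall 0 r).eventually_forall_of_forall_eventually fun z hz =>
      hsum.continuousAt.eventually_mem (hΩ.mem_nhds (mem_innerPoints_iff_forall_add.1 hx z hz))
  exact hev.mono fun y hy => mem_innerPoints_iff_forall_add.2 hy

theorem convex_innerPoints [NormedSpace ℝ E] {Ω : Set E} (hΩ : Convex ℝ Ω) (r : ℝ) :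
    Convex ℝ (innerPoints Ω r) := by
  have : innerPoints Ω r = ⋂ z ∈ closedBall (0 : E) r, (fun x => z + x) ⁻¹' Ω := by
    ext x
    simp only [mem_innerPoints_iff_forall_add, mem_iInter, mem_preimage]
  rw [this]
  exact convex_iInter₂ fun z _ => hΩ.translate_preimage_right z

end InnerPoints

section L1Convergence

variable {α F : Type*} [MeasurableSpace α] [NormedAddCommGroup F] {μ : Measure α}

theorem tendsto_lintegral_enorm_sub_of_tendsto_ae {u : ℕ → α → F} {f : α → F}
    (hu : ∀ n, AEStronglyMeasurable (u n) μ) (hf : Integrable f μ)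
    (hle : ∀ n, ∫⁻ x, ‖u n x‖ₑ ∂μ ≤ ∫⁻ x, ‖f x‖ₑ ∂μ)
    (hlim : ∀ᵐ x ∂μ, Tendsto (fun n => u n x) atTop (𝓝 (f x))) :
    Tendsto (fun n => ∫⁻ x, ‖u n x - f x‖ₑ ∂μ) atTop (𝓝 0) := by
  set I := ∫⁻ x, ‖f x‖ₑ ∂μ with hI
  have hII_top : I + I ≠ ⊤ := ENNReal.add_ne_top.2 ⟨hf.2.ne, hf.2.ne⟩
  have hd : ∀ n, AEMeasurable (fun x => ‖u n x - f x‖ₑ) μ := fun n => ((hu n).sub hf.1).enorm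
  -- Scheffé's trick: Fatou's lemma for the nonnegative functions `h n`.
  let h : ℕ → α → ℝ≥0∞ := fun n x => ‖u n x‖ₑ + ‖f x‖ₑ - ‖u n x - f x‖ₑ
  have hh : ∀ n, ∫⁻ x, h n x ∂μ + ∫⁻ x, ‖u n x - f x‖ₑ ∂μ ≤ I + I := fun n => by
    rw [← lintegral_add_right' _ (hd n)]
    calc ∫⁻ x, h n x + ‖u n x - f x‖ₑ ∂μ = ∫⁻ x, ‖u n x‖ₑ + ‖f x‖ₑ ∂μ :=
          lintegral_congr fun x => tsub_add_cancel_of_le enorm_sub_le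
      _ ≤ I + I := by rw [lintegral_add_right' _ hf.1.enorm]; gcongr; exact hle n
  have hlim_h : ∀ᵐ x ∂μ, Tendsto (fun n => h n x) atTop (𝓝 (‖f x‖ₑ + ‖f x‖ₑ)) := by
    filter_upwards [hlim] with x hx
    have hsub : Tendsto (fun n => ‖u n x - f x‖ₑ) atTop (𝓝 0) := by
      simpa using (hx.sub_const (f x)).enorm
    simpa using ENNReal.Tendsto.sub (hx.enorm.add_const ‖f x‖ₑ) hsub (Or.inl (by simp))
  have hFatou : I + I ≤ liminf (fun n => ∫⁻ x, h n x ∂μ) atTop := calc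
    I + I = ∫⁻ x, liminf (fun n => h n x) atTop ∂μ := by
      rw [hI, ← lintegral_add_right' _ hf.1.enorm]
      exact lintegral_congr_ae (hlim_h.mono fun x hx => hx.liminf_eq.symm)
    _ ≤ _ := lintegral_liminf_le' fun n => ((hu n).enorm.add hf.1.enorm).sub (hd n)
  have hint : Tendsto (fun n => ∫⁻ x, h n x ∂μ) atTop (𝓝 (I + I)) :=
    tendsto_of_le_liminf_of_limsup_le hFatou <|
      limsup_le_of_le (by isBoundedDefault) <|
        Eventually.of_forall fun n => le_self_add.trans (hh n)
  have hzero : Tendsto (fun n => I + I - ∫⁻ x, h n x ∂μ) atTop (𝓝 0) := by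
    simpa using ENNReal.Tendsto.sub tendsto_const_nhds hint (Or.inl hII_top)
  refine tendsto_of_tendsto_of_tendsto_of_le_of_le tendsto_const_nhds hzero
    (fun _ => zero_le) fun n => ?_
  exact ENNReal.le_sub_of_add_le_left (ne_top_of_le_ne_top hII_top (le_self_add.trans (hh n)))
    (hh n)

end L1Convergence

section Mollification

/-- Bump functions around the origin shrinking to it; their normalisations are the smoothing
kernels. -/
noncomputable def bumpSeq {E : Type*} [NormedAddCommGroup E] (n : ℕ) : ContDiffBump (0 : E) where
  rIn := 1 / (2 * ((n : ℝ) + 1))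
  rOut := 1 / ((n : ℝ) + 1)
  rIn_pos := by positivity
  rIn_lt_rOut := one_div_lt_one_div_of_lt (by positivity) (by linarith [n.cast_nonneg (α := ℝ)])

variable {E : Type*} [NormedAddCommGroup E]

theorem tendsto_bumpSeq_rOut :
    Tendsto (fun n => (bumpSeq n : ContDiffBump (0 : E)).rOut) atTop (𝓝 0) :=
  tendsto_one_div_add_atTop_nhds_zero_nat

theorem eventually_mem_innerPoints_bumpSeq {Ω : Set E} (hΩ : IsOpen Ω) {x : E} (hx : x ∈ Ω) :
    ∀ᶠ n in atTop, x ∈ innerPoints Ω (bumpSeq n : ContDiffBump (0 : E)).rOut := by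
  obtain ⟨δ, hδ, hxδ⟩ := exists_subset_innerPoints hΩ isCompact_singleton
    (singleton_subset_iff.2 hx)
  filter_upwards [(tendsto_bumpSeq_rOut (E := E)).eventually (gt_mem_nhds hδ)] with n hn
  exact innerPoints_antitone Ω hn.le (hxδ rfl)

variable [NormedSpace ℝ E] [FiniteDimensional ℝ E] [MeasurableSpace E] [BorelSpace E]
  (μ : Measure E) [μ.IsAddHaarMeasure] (φ : ContDiffBump (0 : E))
  {F : Type*} [NormedAddCommGroup F] [NormedSpace ℝ F] {Ω : Set E} {u : E → F}

/-- The mollification of the extension by zero of `u : Ω → F` with the kernel `φ / ∫ φ`. -/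
noncomputable def mollify (Ω : Set E) (u : E → F) : E → F :=
  φ.normed μ ⋆[ContinuousLinearMap.lsmul ℝ ℝ, μ] Ω.indicator u

theorem mollify_apply (hΩ : MeasurableSet Ω) (u : E → F) (x : E) :
    mollify μ φ Ω u x = ∫ y in Ω, φ.normed μ (x - y) • u y ∂μ := by
  rw [mollify, convolution_lsmul_swap, ← integral_indicator hΩ]
  refine integral_congr_ae (Eventually.of_forall fun y => ?_)
  by_cases hy : y ∈ Ω <;> simp [hy]

theorem contDiff_mollify (hΩ : MeasurableSet Ω) (hu : IntegrableOn u Ω μ) :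
    ContDiff ℝ ∞ (mollify μ φ Ω u) :=
  φ.hasCompactSupport_normed.contDiff_convolution_left _ φ.contDiff_normed
    (hu.integrable_indicator hΩ).locallyIntegrable

theorem integrable_mollify (hΩ : MeasurableSet Ω) (hu : IntegrableOn u Ω μ) :
    Integrable (mollify μ φ Ω u) μ :=
  φ.integrable_normed.integrable_convolution _ (hu.integrable_indicator hΩ)

theorem integrableOn_normed_sub_smul (hu : IntegrableOn u Ω μ) (x : E) :
    IntegrableOn (fun y => φ.normed μ (x - y) • u y) Ω μ := by
  obtain ⟨C, hC⟩ := φ.hasCompactSupport_normed.exists_bound_of_continuous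
    (φ.continuous_normed (μ := μ))
  have hcont : Continuous fun y => φ.normed μ (x - y) :=
    φ.continuous_normed.comp (continuous_sub_left x)
  exact hu.bdd_smul C hcont.aestronglyMeasurable (Eventually.of_forall fun y => hC (x - y))

theorem map_mollify {G : Type*} [NormedAddCommGroup G] [NormedSpace ℝ G]
    [CompleteSpace F] [CompleteSpace G] (L : F →L[ℝ] G) (hΩ : MeasurableSet Ω)
    (hu : IntegrableOn u Ω μ) (x : E) :
    L (mollify μ φ Ω u x) = mollify μ φ Ω (fun y => L (u y)) x := by
  simp only [mollify_apply μ φ hΩ, ← map_smul]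
  exact (L.integral_comp_comm (integrableOn_normed_sub_smul μ φ hu x)).symm

theorem mollify_nonneg (hΩ : MeasurableSet Ω) {u : E → ℝ} (hu : ∀ᵐ x ∂μ.restrict Ω, 0 ≤ u x)
    (x : E) : 0 ≤ mollify μ φ Ω u x := by
  rw [mollify_apply μ φ hΩ]
  exact integral_nonneg_of_ae (hu.mono fun y hy => mul_nonneg (φ.nonneg_normed _) hy)

theorem lintegral_enorm_normed : ∫⁻ x, ‖φ.normed μ x‖ₑ ∂μ = 1 := by
  rw [← ofReal_integral_norm_eq_lintegral_enorm φ.integrable_normed]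
  simp only [Real.norm_of_nonneg (φ.nonneg_normed _), φ.integral_normed, ENNReal.ofReal_one]

theorem lintegral_enorm_mollify_le (hΩ : MeasurableSet Ω) (hu : IntegrableOn u Ω μ) :
    ∫⁻ x, ‖mollify μ φ Ω u x‖ₑ ∂μ ≤ ∫⁻ x in Ω, ‖u x‖ₑ ∂μ := calc
  ∫⁻ x, ‖mollify μ φ Ω u x‖ₑ ∂μ
      ≤ ∫⁻ x, ∫⁻ y in Ω, ‖φ.normed μ (x - y)‖ₑ * ‖u y‖ₑ ∂μ ∂μ := by
    refine lintegral_mono fun x => ?_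
    simp only [mollify_apply μ φ hΩ, ← enorm_smul]
    exact enorm_integral_le_lintegral_enorm _
  _ = ∫⁻ y in Ω, ∫⁻ x, ‖φ.normed μ (x - y)‖ₑ * ‖u y‖ₑ ∂μ ∂μ := by
    refine lintegral_lintegral_swap (AEMeasurable.mul ?_ hu.1.enorm.comp_snd)
    exact (φ.continuous_normed.comp continuous_sub).enorm.measurable.aemeasurable
  _ = ∫⁻ y in Ω, ‖u y‖ₑ ∂μ := by
    refine lintegral_congr fun y => ?_
    rw [lintegral_mul_const' _ _ enorm_ne_top,
      lintegral_sub_right_eq_self (fun x => ‖φ.normed μ x‖ₑ) y, lintegral_enorm_normed, one_mul]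

theorem fderiv_mollify_apply (hΩ : MeasurableSet Ω) (hu : IntegrableOn u Ω μ) (x v : E) :
    fderiv ℝ (mollify μ φ Ω u) x v = ∫ y in Ω, fderiv ℝ (φ.normed μ) (x - y) v • u y ∂μ := by
  have hloc : LocallyIntegrable (Ω.indicator u) μ := (hu.integrable_indicator hΩ).locallyIntegrable
  have hφ : ContDiff ℝ 1 (φ.normed μ) := φ.contDiff_normed
  have hexists := (φ.hasCompactSupport_normed (μ := μ)).fderiv ℝ |>.convolutionExists_left
    ((ContinuousLinearMap.lsmul ℝ ℝ).precompL E) (hφ.continuous_fderiv one_ne_zero) hloc x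
  have hderiv : HasFDerivAt (mollify μ φ Ω u) _ x :=
    φ.hasCompactSupport_normed.hasFDerivAt_convolution_left _ hφ hloc x
  rw [hderiv.fderiv, convolution_eq_swap, ← integral_indicator hΩ,
    ContinuousLinearMap.integral_apply hexists.integrable_swap]
  refine integral_congr_ae (Eventually.of_forall fun y => ?_)
  by_cases hy : y ∈ Ω <;> simp [hy, ContinuousLinearMap.precompL_apply]

theorem map_fderiv_mollify {G : Type*} [NormedAddCommGroup G] [NormedSpace ℝ G]
    [CompleteSpace F] [CompleteSpace G] (L : F →L[ℝ] G) (hΩ : MeasurableSet Ω)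
    (hu : IntegrableOn u Ω μ) (x v : E) :
    L (fderiv ℝ (mollify μ φ Ω u) x v) = fderiv ℝ (mollify μ φ Ω fun y => L (u y)) x v := by
  have hdiff : DifferentiableAt ℝ (mollify μ φ Ω u) x :=
    (contDiff_mollify μ φ hΩ hu).differentiable (by simp) x
  simp_rw [← funext (map_mollify μ φ L hΩ hu)]
  rw [fderiv_fun_comp x L.differentiableAt hdiff, L.fderiv, ContinuousLinearMap.comp_apply]

theorem convexOn_mollify (hΩ : MeasurableSet Ω) {u : E → ℝ} (hu : IntegrableOn u Ω μ)
    (hc : ConvexOn ℝ Ω u) : ConvexOn ℝ (innerPoints Ω φ.rOut) (mollify μ φ Ω u) := by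
  have hint : ∀ x, Integrable (fun t => φ.normed μ t * Ω.indicator u (x - t)) μ := fun x =>
    (φ.hasCompactSupport_normed.convolutionExists_left (ContinuousLinearMap.lsmul ℝ ℝ)
      φ.continuous_normed (hu.integrable_indicator hΩ).locallyIntegrable x).integrable
  refine ⟨convex_innerPoints hc.1 _, fun x hx y hy a b ha hb hab => ?_⟩
  simp only [mollify, convolution_lsmul, smul_eq_mul]
  rw [← integral_const_mul, ← integral_const_mul,
    ← integral_add ((hint x).const_mul a) ((hint y).const_mul b)]
  refine integral_mono (hint _) (((hint x).const_mul a).add ((hint y).const_mul b)) fun t => ?_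
  by_cases ht : t ∈ ball (0 : E) φ.rOut
  · have hmem : ∀ z ∈ innerPoints Ω φ.rOut, z - t ∈ Ω := fun z hz => hz <| by
      simpa [mem_closedBall, dist_eq_norm] using (mem_ball_zero_iff.1 ht).le
    have hcomb : a • x + b • y - t = a • (x - t) + b • (y - t) := by
      rw [smul_sub, smul_sub, sub_add_sub_comm, Convex.combo_self hab]
    have hle := mul_le_mul_of_nonneg_left (hc.2 (hmem x hx) (hmem y hy) ha hb hab)
      (φ.nonneg_normed (μ := μ) t)
    have hmem' : a • x + b • y - t ∈ Ω := hcomb ▸ hc.1 (hmem x hx) (hmem y hy) ha hb hab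
    simp only [indicator_of_mem hmem', indicator_of_mem (hmem x hx), indicator_of_mem (hmem y hy)]
    rw [hcomb]
    simp only [smul_eq_mul] at hle
    linarith
  · have : φ.normed μ t = 0 := by
      rwa [← Function.notMem_support, φ.support_normed_eq]
    simp [this]

variable [CompleteSpace F]

theorem ae_tendsto_mollify (hΩ : MeasurableSet Ω) (hu : IntegrableOn u Ω μ) :
    ∀ᵐ x ∂μ.restrict Ω, Tendsto (fun n => mollify μ (bumpSeq n) Ω u x) atTop (𝓝 (u x)) := by
  have h := ContDiffBump.ae_convolution_tendsto_right_of_locallyIntegrable (K := 2)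
    (φ := bumpSeq) (μ := μ) tendsto_bumpSeq_rOut
    (Eventually.of_forall fun n => le_of_eq (by simp only [bumpSeq]; field_simp))
    (hu.integrable_indicator hΩ).locallyIntegrable
  rw [ae_restrict_iff' hΩ]
  filter_upwards [h] with x hx hxΩ
  rwa [indicator_of_mem hxΩ] at hx

theorem tendsto_lintegral_enorm_mollify_sub (hΩ : MeasurableSet Ω) (hu : IntegrableOn u Ω μ) :
    Tendsto (fun n => ∫⁻ x in Ω, ‖mollify μ (bumpSeq n) Ω u x - u x‖ₑ ∂μ) atTop (𝓝 0) :=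
  tendsto_lintegral_enorm_sub_of_tendsto_ae
    (fun n => (integrable_mollify μ (bumpSeq n) hΩ hu).1.restrict) hu
    (fun n => (setLIntegral_le_lintegral _ _).trans
      (lintegral_enorm_mollify_le μ (bumpSeq n) hΩ hu))
    (ae_tendsto_mollify μ hΩ hu)

end Mollification

section LinearForms

/-- The linear form `v ↦ w₀ v₀ + w₁ v₁`, depending linearly on `w`. It turns the vector field of
partial derivatives of a function into its Fréchet derivative. -/
noncomputable def linearForm : (Fin 2 → ℝ) →L[ℝ] Plane →L[ℝ] ℝ :=
  ∑ i, (ContinuousLinearMap.proj i).smulRight (EuclideanSpace.proj i)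

theorem linearForm_apply (w : Fin 2 → ℝ) (v : Plane) : linearForm w v = w ⬝ᵥ v := by
  simp [linearForm, dotProduct]

theorem linearForm_apply_single (w : Fin 2 → ℝ) (i : Fin 2) :
    linearForm w (EuclideanSpace.single i 1) = w i := by
  simp [linearForm_apply]

theorem eq_linearForm (L : Plane →L[ℝ] ℝ) :
    L = linearForm fun i => L (EuclideanSpace.single i 1) := by
  refine ContinuousLinearMap.coe_injective <|
    (EuclideanSpace.basisFun (Fin 2) ℝ).toBasis.ext fun i => ?_
  simp [linearForm_apply_single]

end LinearForms

section TestFunctions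

variable {Ω : Set Plane} {φ : Plane → ℝ}

theorem IsTestFunction.partialDeriv (hφ : IsTestFunction Ω φ) (i : Fin 2) :
    IsTestFunction Ω (partialDeriv i φ) where
  smooth := (hφ.smooth.fderiv_right (m := ∞) (by simp)).clm_apply contDiff_const
  hasCompactSupport := hφ.hasCompactSupport.fderiv_apply ℝ _
  tsupport_subset := (tsupport_fderiv_apply_subset ℝ _).trans hφ.tsupport_subset

theorem IsTestFunction.partialDeriv_comm (hφ : IsTestFunction Ω φ) (i j : Fin 2) :
    _root_.partialDeriv i (_root_.partialDeriv j φ) =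
      _root_.partialDeriv j (_root_.partialDeriv i φ) := by
  ext x
  have hsymm : IsSymmSndFDerivAt ℝ φ x := hφ.smooth.contDiffAt.isSymmSndFDerivAt (by
    rw [minSmoothness_of_isRCLikeNormedField]; exact ENat.LEInfty.out)
  have hdiff : DifferentiableAt ℝ (fderiv ℝ φ) x :=
    (hφ.smooth.fderiv_right (m := ∞) (by simp)).differentiable (by simp) x
  have hsnd (k l : Fin 2) : _root_.partialDeriv k (_root_.partialDeriv l φ) x =
      fderiv ℝ (fderiv ℝ φ) x (EuclideanSpace.single k 1) (EuclideanSpace.single l 1) := by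
    unfold _root_.partialDeriv
    rw [fderiv_clm_apply hdiff (differentiableAt_const _)]
    simp
  rw [hsnd, hsnd]
  exact hsymm.eq _ _

theorem IsTestFunction.integrable_mul (hφ : IsTestFunction Ω φ) {u : Plane → ℝ}
    (hu : LocallyIntegrableOn u Ω) : Integrable fun x => u x * φ x := by
  have hsupp : IntegrableOn (fun x => u x * φ x) (tsupport φ) :=
    (hu.integrableOn_compact_subset hφ.tsupport_subset hφ.hasCompactSupport).mul_continuousOn
      hφ.smooth.continuous.continuousOn hφ.hasCompactSupport
  refine hsupp.integrable_of_forall_notMem_eq_zero fun x hx => ?_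
  rw [image_eq_zero_of_notMem_tsupport hx, mul_zero]

theorem IsTestFunction.setIntegral_mul_eq {U : Set Plane} (hφ : IsTestFunction U φ)
    (hΩ : MeasurableSet Ω) (hUΩ : U ⊆ Ω) (u : Plane → ℝ) :
    ∫ x in U, u x * φ x = ∫ x in Ω, u x * φ x :=
  (setIntegral_eq_of_subset_of_forall_sdiff_eq_zero hΩ hUΩ fun x hx => by
    rw [image_eq_zero_of_notMem_tsupport fun h => hx.2 (hφ.tsupport_subset h), mul_zero]).symm

theorem IsTestFunction.setIntegral_mul_eq_integral (hφ : IsTestFunction Ω φ) (u : Plane → ℝ) :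
    ∫ x in Ω, u x * φ x = ∫ x, u x * φ x := by
  simpa using hφ.setIntegral_mul_eq MeasurableSet.univ (subset_univ Ω) u

theorem IsTestFunction.tendsto_integral_mul (hφ : IsTestFunction Ω φ) {u : Plane → ℝ}
    {U : ℕ → Plane → ℝ} (hu : IntegrableOn u Ω) (hU : ∀ n, IntegrableOn (U n) Ω)
    (hlim : Tendsto (fun n => ∫⁻ x in Ω, ‖U n x - u x‖ₑ) atTop (𝓝 0)) :
    Tendsto (fun n => ∫ x in Ω, U n x * φ x) atTop (𝓝 (∫ x in Ω, u x * φ x)) := by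
  obtain ⟨C, hC⟩ := hφ.hasCompactSupport.exists_bound_of_continuous hφ.smooth.continuous
  refine tendsto_integral_of_L1 _ (hφ.integrable_mul hu.locallyIntegrableOn).integrableOn.1
    (Eventually.of_forall fun n => (hφ.integrable_mul (hU n).locallyIntegrableOn).integrableOn) ?_
  have hbound (n : ℕ) : ∫⁻ x in Ω, ‖U n x * φ x - u x * φ x‖ₑ ≤
      (∫⁻ x in Ω, ‖U n x - u x‖ₑ) * ENNReal.ofReal C := by
    rw [← lintegral_mul_const' _ _ ENNReal.ofReal_ne_top]
    refine lintegral_mono fun x => ?_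
    rw [← sub_mul, enorm_mul]
    gcongr
    rw [← ofReal_norm]
    exact ENNReal.ofReal_le_ofReal (hC x)
  refine tendsto_of_tendsto_of_tendsto_of_le_of_le tendsto_const_nhds ?_ (fun _ => zero_le) hbound
  simpa using ENNReal.Tendsto.mul_const hlim (Or.inr ENNReal.ofReal_ne_top)

theorem isTestFunction_normed_sub {ψ : ContDiffBump (0 : Plane)} {x : Plane}
    (hx : x ∈ innerPoints Ω ψ.rOut) : IsTestFunction Ω fun y => ψ.normed volume (x - y) := by
  have hsupp : tsupport (fun y => ψ.normed volume (x - y)) ⊆ closedBall x ψ.rOut := by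
    refine closure_minimal (fun y hy => ?_) isClosed_closedBall
    have hxy : x - y ∈ Function.support (ψ.normed volume) := hy
    rw [ψ.support_normed_eq, mem_ball_zero_iff] at hxy
    simpa [dist_comm, dist_eq_norm] using hxy.le
  exact ⟨ψ.contDiff_normed.comp (contDiff_const.sub contDiff_id),
    (isCompact_closedBall _ _).of_isClosed_subset (isClosed_tsupport _) hsupp, hsupp.trans hx⟩

theorem partialDeriv_comp_sub (hφ : Differentiable ℝ φ) (i : Fin 2) (x y : Plane) :
    partialDeriv i (fun y => φ (x - y)) y = -partialDeriv i φ (x - y) := by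
  have hderiv := (hφ (x - y)).hasFDerivAt.comp y ((hasFDerivAt_id y).const_sub x)
  rw [partialDeriv, HasFDerivAt.fderiv (f := fun y => φ (x - y)) hderiv]
  simp [partialDeriv]

end TestFunctions

section WeakDerivatives

variable {Ω : Set Plane} {i : Fin 2} {u u' v v' : Plane → ℝ}

theorem HasWeakPartial.ae_eq (hΩ : IsOpen Ω) (h : HasWeakPartial Ω i u v)
    (h' : HasWeakPartial Ω i u v') : v =ᵐ[volume.restrict Ω] v' := by
  have hzero : ∀ᵐ x, x ∈ Ω → (v - v') x = 0 := by
    refine hΩ.ae_eq_zero_of_integral_contDiff_smul_eq_zero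
      (h.locallyIntegrable_deriv.sub h'.locallyIntegrable_deriv) fun φ hsmooth hcompact hsupp => ?_
    have hφ : IsTestFunction Ω φ := ⟨hsmooth, hcompact, hsupp⟩
    calc ∫ x, φ x • (v - v') x = ∫ x, (v x * φ x - v' x * φ x) := by
          simp only [Pi.sub_apply, smul_eq_mul, mul_sub, mul_comm]
      _ = 0 := by
          rw [integral_sub (hφ.integrable_mul h.locallyIntegrable_deriv)
              (hφ.integrable_mul h'.locallyIntegrable_deriv),
            ← hφ.setIntegral_mul_eq_integral, ← hφ.setIntegral_mul_eq_integral]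
          linarith [h.integral_eq φ hφ, h'.integral_eq φ hφ]
  filter_upwards [(ae_restrict_iff' hΩ.measurableSet).2 hzero] with x hx using sub_eq_zero.1 hx

theorem HasWeakPartial.congr (h : HasWeakPartial Ω i u v) (hu : u =ᵐ[volume.restrict Ω] u')
    (hv : v =ᵐ[volume.restrict Ω] v') : HasWeakPartial Ω i u' v' where
  locallyIntegrable_fun := h.locallyIntegrable_fun.congr hu
  locallyIntegrable_deriv := h.locallyIntegrable_deriv.congr hv
  integral_eq φ hφ := by
    have huφ : ∫ x in Ω, u' x * partialDeriv i φ x = ∫ x in Ω, u x * partialDeriv i φ x :=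
      integral_congr_ae (by filter_upwards [hu] with x hx; rw [hx])
    have hvφ : ∫ x in Ω, v' x * φ x = ∫ x in Ω, v x * φ x :=
      integral_congr_ae (by filter_upwards [hv] with x hx; rw [hx])
    rw [huφ, hvφ, h.integral_eq φ hφ]

theorem HasWeakPartial.sub (h : HasWeakPartial Ω i u v) (h' : HasWeakPartial Ω i u' v') :
    HasWeakPartial Ω i (fun x => u x - u' x) (fun x => v x - v' x) where
  locallyIntegrable_fun := h.locallyIntegrable_fun.sub h'.locallyIntegrable_fun
  locallyIntegrable_deriv := h.locallyIntegrable_deriv.sub h'.locallyIntegrable_deriv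
  integral_eq φ hφ := by
    simp only [sub_mul]
    rw [integral_sub ((hφ.partialDeriv i).integrable_mul h.locallyIntegrable_fun).integrableOn
        ((hφ.partialDeriv i).integrable_mul h'.locallyIntegrable_fun).integrableOn,
      integral_sub (hφ.integrable_mul h.locallyIntegrable_deriv).integrableOn
        (hφ.integrable_mul h'.locallyIntegrable_deriv).integrableOn,
      h.integral_eq φ hφ, h'.integral_eq φ hφ]
    ring

theorem HasWeakPartial.of_tendsto {U V : ℕ → Plane → ℝ} (hu : IntegrableOn u Ω)
    (hv : IntegrableOn v Ω) (hU : ∀ n, IntegrableOn (U n) Ω) (hV : ∀ n, IntegrableOn (V n) Ω)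
    (hUu : Tendsto (fun n => ∫⁻ x in Ω, ‖U n x - u x‖ₑ) atTop (𝓝 0))
    (hVv : Tendsto (fun n => ∫⁻ x in Ω, ‖V n x - v x‖ₑ) atTop (𝓝 0))
    (h : ∀ φ, IsTestFunction Ω φ → ∀ᶠ n in atTop,
      ∫ x in Ω, U n x * partialDeriv i φ x = -∫ x in Ω, V n x * φ x) :
    HasWeakPartial Ω i u v where
  locallyIntegrable_fun := hu.locallyIntegrableOn
  locallyIntegrable_deriv := hv.locallyIntegrableOn
  integral_eq φ hφ := tendsto_nhds_unique_of_eventuallyEq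
    ((hφ.partialDeriv i).tendsto_integral_mul hu hU hUu)
    (hφ.tendsto_integral_mul hv hV hVv).neg (h φ hφ)

theorem HasWeakPartial.integral_eq_of_subset {U : Set Plane} {φ : Plane → ℝ}
    (h : HasWeakPartial U i u v) (hΩ : MeasurableSet Ω) (hUΩ : U ⊆ Ω) (hφ : IsTestFunction U φ) :
    ∫ x in Ω, u x * partialDeriv i φ x = -∫ x in Ω, v x * φ x := by
  rw [← (hφ.partialDeriv i).setIntegral_mul_eq hΩ hUΩ, ← hφ.setIntegral_mul_eq hΩ hUΩ]
  exact h.integral_eq φ hφ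

theorem HasWeakPartial.partialDeriv_mollify {ψ : ContDiffBump (0 : Plane)} {x : Plane}
    (h : HasWeakPartial Ω i u v) (hΩ : MeasurableSet Ω) (hu : IntegrableOn u Ω)
    (hx : x ∈ innerPoints Ω ψ.rOut) :
    partialDeriv i (mollify volume ψ Ω u) x = mollify volume ψ Ω v x := by
  have hparts := h.integral_eq _ (isTestFunction_normed_sub hx)
  simp only [partialDeriv_comp_sub (ψ.contDiff_normed.differentiable one_ne_zero), mul_neg,
    integral_neg, neg_inj] at hparts
  rw [partialDeriv, fderiv_mollify_apply volume ψ hΩ hu, mollify_apply volume ψ hΩ]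
  simpa only [smul_eq_mul, mul_comm, partialDeriv] using hparts

theorem HasWeakGradient.fderiv_mollify {g : Plane → Fin 2 → ℝ} {ψ : ContDiffBump (0 : Plane)}
    {x : Plane} (h : HasWeakGradient Ω u g) (hΩ : MeasurableSet Ω) (hu : IntegrableOn u Ω)
    (hg : IntegrableOn g Ω) (hx : x ∈ innerPoints Ω ψ.rOut) :
    fderiv ℝ (mollify volume ψ Ω u) x = linearForm (mollify volume ψ Ω g x) := by
  rw [eq_linearForm (fderiv ℝ (mollify volume ψ Ω u) x)]
  congr 1
  ext i
  exact ((h i).partialDeriv_mollify hΩ hu hx).trans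
    (map_mollify volume ψ (ContinuousLinearMap.proj i) hΩ hg x).symm

theorem HasWeakGradient.congr {g g' : Plane → Fin 2 → ℝ} (h : HasWeakGradient Ω u g)
    (hu : u =ᵐ[volume.restrict Ω] u') (hg : g =ᵐ[volume.restrict Ω] g') :
    HasWeakGradient Ω u' g' :=
  fun i => (h i).congr hu (hg.fun_comp fun w => w i)

theorem hasWeakGradient_of_hasFDerivAt {f : Plane → ℝ} {F : Plane → Fin 2 → ℝ} (hΩ : IsOpen Ω)
    (hf : ∀ x ∈ Ω, HasFDerivAt f (linearForm (F x)) x) (hF : ContinuousOn F Ω) :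
    HasWeakGradient Ω f F := by
  intro i
  have hfloc : LocallyIntegrableOn f Ω := ContinuousOn.locallyIntegrableOn
    (fun x hx => (hf x hx).continuousAt.continuousWithinAt) hΩ.measurableSet
  have hFloc : LocallyIntegrableOn (fun x => F x i) Ω :=
    (continuousOn_pi.1 hF i).locallyIntegrableOn hΩ.measurableSet
  refine ⟨hfloc, hFloc, fun φ hφ => ?_⟩
  have hderiv (x : Plane) : fderiv ℝ f x (EuclideanSpace.single i 1) * φ x = F x i * φ x := by
    by_cases hx : x ∈ tsupport φ
    · rw [(hf x (hφ.tsupport_subset hx)).fderiv, linearForm_apply_single]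
    · simp [image_eq_zero_of_notMem_tsupport hx]
  rw [(hφ.partialDeriv i).setIntegral_mul_eq_integral, hφ.setIntegral_mul_eq_integral]
  simp only [← hderiv]
  refine integral_mul_fderiv_eq_neg_fderiv_mul_of_integrable ?_
    ((hφ.partialDeriv i).integrable_mul hfloc) (hφ.integrable_mul hfloc)
    (fun x hx => (hf x (hφ.tsupport_subset hx)).differentiableAt)
    fun x _ => hφ.smooth.differentiable (by simp) x
  simpa only [hderiv] using hφ.integrable_mul hFloc

theorem HasWeakGradient.exists_ae_eq_const (hΩ : IsOpen Ω) (hconvex : Convex ℝ Ω)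
    (hu : IntegrableOn u Ω) (h : HasWeakGradient Ω u 0) :
    ∃ c, u =ᵐ[volume.restrict Ω] fun _ => c := by
  rcases eq_or_neBot (ae (volume.restrict Ω)) with hbot | hne
  · exact ⟨0, by rw [hbot]; exact Filter.eventually_bot⟩
  have hlim := ae_tendsto_mollify volume hΩ.measurableSet hu
  obtain ⟨y, hy, hyΩ⟩ := (hlim.and (ae_restrict_mem hΩ.measurableSet)).exists
  refine ⟨u y, ?_⟩
  filter_upwards [hlim, ae_restrict_mem hΩ.measurableSet] with x hx hxΩ
  refine tendsto_nhds_unique_of_eventuallyEq hx hy ?_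
  filter_upwards [eventually_mem_innerPoints_bumpSeq hΩ hxΩ,
    eventually_mem_innerPoints_bumpSeq hΩ hyΩ] with n hxn hyn
  refine (isOpen_innerPoints hΩ _).is_const_of_fderiv_eq_zero
    (convex_innerPoints hconvex _).isPreconnected
    ((contDiff_mollify volume _ hΩ.measurableSet hu).differentiable (by simp)).differentiableOn
    (fun z hz => ?_) hxn hyn
  rw [h.fderiv_mollify hΩ.measurableSet hu (integrable_zero _ _ _) hz,
    mollify_apply _ _ hΩ.measurableSet]
  simp

theorem hasWeakGradient_affineMap (hΩ : IsOpen Ω) (a : Plane →ᵃ[ℝ] ℝ) :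
    HasWeakGradient Ω a fun _ i => a.linear (EuclideanSpace.single i 1) := by
  refine hasWeakGradient_of_hasFDerivAt hΩ (fun x _ => ?_) continuousOn_const
  suffices hderiv : HasFDerivAt a (LinearMap.toContinuousLinearMap a.linear) x by
    rwa [eq_linearForm (LinearMap.toContinuousLinearMap a.linear)] at hderiv
  rw [a.decomp]
  exact (LinearMap.toContinuousLinearMap a.linear).hasFDerivAt.add_const (a 0)

theorem exists_affineMap_ae_eq (hΩ : IsOpen Ω) (hconvex : Convex ℝ Ω)
    (hbounded : Bornology.IsBounded Ω) {g : Plane → Fin 2 → ℝ} (hu : IntegrableOn u Ω)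
    (hg : IntegrableOn g Ω) (h : HasWeakGradient Ω u g)
    (hzero : ∀ i, HasWeakGradient Ω (fun x => g x i) 0) :
    ∃ a : Plane →ᵃ[ℝ] ℝ, u =ᵐ[volume.restrict Ω] a := by
  choose c hc using fun i => (hzero i).exists_ae_eq_const hΩ hconvex (hg.eval i)
  let ℓ : Plane →ᵃ[ℝ] ℝ := (linearForm c).toLinearMap.toAffineMap
  have hℓ : HasWeakGradient Ω ℓ fun _ => c := by
    simpa [ℓ, linearForm_apply_single] using hasWeakGradient_affineMap hΩ ℓ
  have hℓint : IntegrableOn ℓ Ω :=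
    ((linearForm c).continuous.continuousOn.integrableOn_compact
      hbounded.isCompact_closure).mono_set subset_closure
  have hdiff : HasWeakGradient Ω (fun x => u x - ℓ x) 0 := fun i =>
    ((h i).sub (hℓ i)).congr EventuallyEq.rfl (by filter_upwards [hc i] with x hx; simp [hx])
  obtain ⟨b, hb⟩ := hdiff.exists_ae_eq_const hΩ hconvex (hu.sub hℓint)
  refine ⟨ℓ + AffineMap.const ℝ Plane b, ?_⟩
  filter_upwards [hb] with x hx
  simp [← hx]

end WeakDerivatives

section WeakHessians

variable {Ω : Set Plane} {s s' : Plane → ℝ} {H H' : Plane → Mat2}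

theorem HasWeakHessian.ae_eq (hΩ : IsOpen Ω) (h : HasWeakHessian Ω s H)
    (h' : HasWeakHessian Ω s H') : H =ᵐ[volume.restrict Ω] H' := by
  obtain ⟨g, hg, hH⟩ := h
  obtain ⟨g', hg', hH'⟩ := h'
  have hentry (i j : Fin 2) : ∀ᵐ x ∂volume.restrict Ω, H x i j = H' x i j :=
    (hH i j).ae_eq hΩ ((hH' i j).congr ((hg' i).ae_eq hΩ (hg i)) EventuallyEq.rfl)
  filter_upwards [ae_all_iff.2 fun i => ae_all_iff.2 (hentry i)] with x hx using Matrix.ext hx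

theorem HasWeakHessian.congr (h : HasWeakHessian Ω s H) (hs : s =ᵐ[volume.restrict Ω] s')
    (hH : H =ᵐ[volume.restrict Ω] H') : HasWeakHessian Ω s' H' := by
  obtain ⟨g, hg, hgH⟩ := h
  exact ⟨g, hg.congr hs EventuallyEq.rfl,
    fun i => (hgH i).congr EventuallyEq.rfl (hH.fun_comp fun M => M i)⟩

theorem HasWeakHessian.ae_isSymm (hΩ : IsOpen Ω) (h : HasWeakHessian Ω s H) :
    ∀ᵐ x ∂volume.restrict Ω, (H x).IsSymm := by
  obtain ⟨g, hg, hgH⟩ := h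
  have hcomm (i j : Fin 2) : HasWeakPartial Ω j (fun x => g x i) fun x => H x j i := by
    refine ⟨(hg i).locallyIntegrable_deriv, (hgH j i).locallyIntegrable_deriv, fun φ hφ => ?_⟩
    have hij := (hg i).integral_eq _ (hφ.partialDeriv j)
    rw [hφ.partialDeriv_comm i j] at hij
    linarith [(hg j).integral_eq _ (hφ.partialDeriv i), (hgH j i).integral_eq φ hφ]
  filter_upwards [ae_all_iff.2 fun i => ae_all_iff.2 fun j => (hcomm i j).ae_eq hΩ (hgH i j)]
    with x hx using Matrix.ext hx

theorem HasWeakHessian.of_sub_eq_affineMap (hΩ : IsOpen Ω) (h : HasWeakHessian Ω s H)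
    {a : Plane →ᵃ[ℝ] ℝ} (ha : ∀ x ∈ Ω, s x - s' x = a x) : HasWeakHessian Ω s' H := by
  obtain ⟨g, hg, hgH⟩ := h
  refine ⟨fun x i => g x i - a.linear (EuclideanSpace.single i 1), fun i => ?_, fun i j => ?_⟩
  · refine ((hg i).sub (hasWeakGradient_affineMap hΩ a i)).congr ?_ EventuallyEq.rfl
    filter_upwards [ae_restrict_mem hΩ.measurableSet] with x hx
    linarith [ha x hx]
  · have hconst := hasWeakGradient_affineMap hΩ
      (AffineMap.const ℝ Plane (a.linear (EuclideanSpace.single i 1)))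
    simpa using (hgH i j).sub (hconst j)

theorem MemW21.integrableOn_gradient (h : MemW21 Ω s) (hΩ : IsOpen Ω) {g : Plane → Fin 2 → ℝ}
    (hg : HasWeakGradient Ω s g) : IntegrableOn g Ω := by
  obtain ⟨g', hg', hint⟩ := h.exists_gradient
  exact Integrable.of_eval fun i => (hint i).congr ((hg' i).ae_eq hΩ (hg i))

theorem MemW21.integrableOn_hessian (h : MemW21 Ω s) (hΩ : IsOpen Ω)
    (hH : HasWeakHessian Ω s H) : IntegrableOn (fun x i j => H x i j) Ω := by
  obtain ⟨H', hH', hint⟩ := h.exists_hessian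
  exact Integrable.of_eval fun i => Integrable.of_eval fun j =>
    (hint i j).congr ((hH'.ae_eq hΩ hH).fun_comp fun M => M i j)

theorem MemW21.congr (h : MemW21 Ω s) (hs : s =ᵐ[volume.restrict Ω] s') : MemW21 Ω s' where
  integrable := Integrable.congr h.integrable hs
  exists_gradient := h.exists_gradient.imp fun _ hg => ⟨hg.1.congr hs EventuallyEq.rfl, hg.2⟩
  exists_hessian := h.exists_hessian.imp fun _ hH => ⟨hH.1.congr hs EventuallyEq.rfl, hH.2⟩

end WeakHessians

section CurlFree

variable {Ω : Set Plane} {F F' : Plane → Fin 2 → ℝ}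

/-- The vector field `F` is weakly curl-free on `Ω`: `∂ⱼ Fᵢ = ∂ᵢ Fⱼ` in the sense of
distributions. -/
def IsCurlFree (Ω : Set Plane) (F : Plane → Fin 2 → ℝ) : Prop :=
  ∀ φ : Plane → ℝ, IsTestFunction Ω φ → ∀ i j,
    ∫ x in Ω, F x i * partialDeriv j φ x = ∫ x in Ω, F x j * partialDeriv i φ x

theorem HasWeakGradient.isCurlFree {u : Plane → ℝ} (h : HasWeakGradient Ω u F) :
    IsCurlFree Ω F := fun φ hφ i j => by
  have hij := (h i).integral_eq _ (hφ.partialDeriv j)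
  rw [hφ.partialDeriv_comm i j] at hij
  linarith [(h j).integral_eq _ (hφ.partialDeriv i)]

theorem IsCurlFree.congr (h : IsCurlFree Ω F) (hF : F =ᵐ[volume.restrict Ω] F') :
    IsCurlFree Ω F' := fun φ hφ i j => by
  have hcomp (k l : Fin 2) :
      ∫ x in Ω, F' x k * partialDeriv l φ x = ∫ x in Ω, F x k * partialDeriv l φ x :=
    integral_congr_ae (by filter_upwards [hF] with x hx; rw [hx])
  rw [hcomp, hcomp, h φ hφ]

theorem IsCurlFree.fderiv_mollify_comm (h : IsCurlFree Ω F) (hΩ : MeasurableSet Ω)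
    (hF : IntegrableOn F Ω) {ψ : ContDiffBump (0 : Plane)} {x : Plane}
    (hx : x ∈ innerPoints Ω ψ.rOut) (v w : Plane) :
    fderiv ℝ (fun z => linearForm (mollify volume ψ Ω F z)) x v w =
      fderiv ℝ (fun z => linearForm (mollify volume ψ Ω F z)) x w v := by
  set B := fderiv ℝ (fun z => linearForm (mollify volume ψ Ω F z)) x with hB
  have hcoord (i j : Fin 2) : B (EuclideanSpace.single i 1) (EuclideanSpace.single j 1) =
      ∫ y in Ω, partialDeriv i (ψ.normed volume) (x - y) * F y j := by
    have hdiff : DifferentiableAt ℝ (mollify volume ψ Ω F) x :=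
      (contDiff_mollify volume ψ hΩ hF).differentiable (by simp) x
    rw [hB, fderiv_fun_comp x linearForm.differentiableAt hdiff, linearForm.fderiv,
      ContinuousLinearMap.comp_apply, linearForm_apply_single]
    exact (map_fderiv_mollify volume ψ (ContinuousLinearMap.proj (R := ℝ) j) hΩ hF x _).trans
      (fderiv_mollify_apply volume ψ hΩ (hF.eval j) x _)
  have hcurl := h _ (isTestFunction_normed_sub hx)
  simp only [partialDeriv_comp_sub (ψ.contDiff_normed.differentiable one_ne_zero), mul_neg,
    integral_neg, neg_inj] at hcurl
  suffices hflip : B = B.flip from congrArg (fun L => L v w) hflip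
  refine ContinuousLinearMap.coe_injective <|
    (EuclideanSpace.basisFun (Fin 2) ℝ).toBasis.ext fun i => ContinuousLinearMap.coe_injective <|
      (EuclideanSpace.basisFun (Fin 2) ℝ).toBasis.ext fun j => ?_
  simpa [hcoord, mul_comm] using hcurl j i

end CurlFree

section Convexity

variable {E : Type*} [NormedAddCommGroup E] [NormedSpace ℝ E]

theorem hasDerivAt_comp_lineMap {f : E → ℝ} (hf : Differentiable ℝ f) (x y : E) (t : ℝ) :
    HasDerivAt (fun t => f (AffineMap.lineMap x y t))
      (fderiv ℝ f (AffineMap.lineMap x y t) (y - x)) t :=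
  (hf _).hasFDerivAt.comp_hasDerivAt t AffineMap.hasDerivAt_lineMap

theorem hasDerivAt_fderiv_comp_lineMap {f : E → ℝ} (hf : ContDiff ℝ 2 f) (x y : E) (t : ℝ) :
    HasDerivAt (fun t => fderiv ℝ f (AffineMap.lineMap x y t) (y - x))
      (fderiv ℝ (fderiv ℝ f) (AffineMap.lineMap x y t) (y - x) (y - x)) t := by
  have hf' : Differentiable ℝ (fderiv ℝ f) :=
    (hf.fderiv_right (m := 1) (by norm_num)).differentiable one_ne_zero
  simpa using ((hf' _).hasFDerivAt.comp_hasDerivAt t AffineMap.hasDerivAt_lineMap).clm_apply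
    (hasDerivAt_const t (y - x))

theorem convexOn_of_fderiv2_nonneg {f : E → ℝ} {U : Set E} (hU : Convex ℝ U)
    (hf : ContDiff ℝ 2 f) (hnonneg : ∀ x ∈ U, ∀ v, 0 ≤ fderiv ℝ (fderiv ℝ f) x v v) :
    ConvexOn ℝ U f := by
  refine ⟨hU, fun x hx y hy a b ha hb hab => ?_⟩
  have hderiv := hasDerivAt_comp_lineMap (hf.differentiable two_ne_zero) x y
  have hline : ConvexOn ℝ (Icc (0 : ℝ) 1) fun t => f (AffineMap.lineMap x y t) :=
    convexOn_of_hasDerivWithinAt2_nonneg (convex_Icc 0 1)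
      (fun t _ => (hderiv t).continuousAt.continuousWithinAt)
      (fun t _ => (hderiv t).hasDerivWithinAt)
      (fun t _ => (hasDerivAt_fderiv_comp_lineMap hf x y t).hasDerivWithinAt)
      fun t ht => hnonneg _ (hU.lineMap_mem hx hy (interior_subset ht)) _
  obtain rfl : a = 1 - b := eq_sub_of_add_eq hab
  simpa [AffineMap.lineMap_apply_module] using
    hline.2 (left_mem_Icc.2 zero_le_one) (right_mem_Icc.2 zero_le_one) ha hb hab

theorem fderiv2_nonneg_of_convexOn {f : E → ℝ} {U : Set E} (hU : IsOpen U) (hf : ContDiff ℝ 2 f)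
    (hconvex : ConvexOn ℝ U f) {x : E} (hx : x ∈ U) (v : E) :
    0 ≤ fderiv ℝ (fderiv ℝ f) x v v := by
  set T : Set ℝ := AffineMap.lineMap x (x + v) ⁻¹' U
  have hderiv := hasDerivAt_comp_lineMap (hf.differentiable two_ne_zero) x (x + v)
  have hline : ConvexOn ℝ T fun t => f (AffineMap.lineMap x (x + v) t) :=
    hconvex.comp_affineMap (AffineMap.lineMap x (x + v))
  have hmono : MonotoneOn (fun t => fderiv ℝ f (AffineMap.lineMap x (x + v) t) (x + v - x)) T :=
    (hline.monotoneOn_deriv fun t _ => (hderiv t).differentiableAt).congr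
      fun t _ => (hderiv t).deriv
  have hzero : (0 : ℝ) ∈ T := by simpa [T] using hx
  have hacc : AccPt (0 : ℝ) (𝓟 T) :=
    ((hU.preimage AffineMap.lineMap_continuous).uniqueDiffOn (𝕜 := ℝ) 0 hzero).accPt
  simpa using (hasDerivAt_fderiv_comp_lineMap hf x (x + v) 0).hasDerivWithinAt
    |>.nonneg_of_monotoneOn hacc hmono

theorem subset_convexHull_inter_of_dense [FiniteDimensional ℝ E] {Ω D : Set E} (hΩ : IsOpen Ω)
    (hD : Dense D) : Ω ⊆ convexHull ℝ (D ∩ Ω) := by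
  rcases Ω.eq_empty_or_nonempty with rfl | hne
  · simp
  have hclosure : Ω ⊆ closure (D ∩ Ω) := by
    rw [inter_comm]
    exact hD.open_subset_closure_inter hΩ
  have hspan : affineSpan ℝ (D ∩ Ω) = ⊤ := by
    rw [← top_le_iff, ← hΩ.affineSpan_eq_top hne, affineSpan_le]
    exact hclosure.trans (closure_minimal (subset_affineSpan ℝ _)
      (AffineSubspace.closed_of_finiteDimensional _))
  have hinterior : (interior (convexHull ℝ (D ∩ Ω))).Nonempty :=
    interior_convexHull_nonempty_iff_affineSpan_eq_top.2 hspan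
  calc Ω ⊆ interior (closure (convexHull ℝ (D ∩ Ω))) :=
        interior_maximal (hclosure.trans (closure_mono (subset_convexHull ℝ _))) hΩ
    _ = interior (convexHull ℝ (D ∩ Ω)) :=
        (convex_convexHull ℝ _).interior_closure_eq_interior_of_nonempty_interior hinterior
    _ ⊆ convexHull ℝ (D ∩ Ω) := interior_subset

section Limits

variable {ι : Type*} {l : Filter ι} {Ω D : Set E} {f : ι → E → ℝ} {C : ι → Set E}

theorem eventually_convex_combination_le {x y : E} (hf : ∀ n, ConvexOn ℝ (C n) (f n))
    (hx : ∀ᶠ n in l, x ∈ C n) (hy : ∀ᶠ n in l, y ∈ C n) {a b A B : ℝ} (ha : 0 ≤ a) (hb : 0 ≤ b)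
    (hab : a + b = 1) (hA : ∀ᶠ n in l, f n x ≤ A) (hB : ∀ᶠ n in l, f n y ≤ B) :
    ∀ᶠ n in l, f n (a • x + b • y) ≤ a * A + b * B := by
  filter_upwards [hx, hy, hA, hB] with n hxn hyn hAn hBn
  calc f n (a • x + b • y) ≤ a • f n x + b • f n y := (hf n).2 hxn hyn ha hb hab
    _ ≤ a * A + b * B := by simp only [smul_eq_mul]; gcongr

theorem exists_eventually_le_of_dense [FiniteDimensional ℝ E] (hΩ : IsOpen Ω)
    (hΩconvex : Convex ℝ Ω) (hf : ∀ n, ConvexOn ℝ (C n) (f n))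
    (hC : ∀ x ∈ Ω, ∀ᶠ n in l, x ∈ C n) (hD : Dense D)
    (hbdd : ∀ x ∈ D ∩ Ω, ∃ A, ∀ᶠ n in l, f n x ≤ A) {x : E} (hx : x ∈ Ω) :
    ∃ A, ∀ᶠ n in l, f n x ≤ A := by
  have hconvex : Convex ℝ {x ∈ Ω | ∃ A, ∀ᶠ n in l, f n x ≤ A} := by
    rintro x ⟨hxΩ, A, hA⟩ y ⟨hyΩ, B, hB⟩ a b ha hb hab
    exact ⟨hΩconvex hxΩ hyΩ ha hb hab, _,
      eventually_convex_combination_le hf (hC x hxΩ) (hC y hyΩ) ha hb hab hA hB⟩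
  have hsubset : D ∩ Ω ⊆ {x ∈ Ω | ∃ A, ∀ᶠ n in l, f n x ≤ A} := fun y hy => ⟨hy.2, hbdd y hy⟩
  exact (convexHull_min hsubset hconvex (subset_convexHull_inter_of_dense hΩ hD hx)).2

theorem exists_eventually_ge_of_dense (hΩ : IsOpen Ω) (hf : ∀ n, ConvexOn ℝ (C n) (f n))
    (hC : ∀ x ∈ Ω, ∀ᶠ n in l, x ∈ C n) (hD : Dense D)
    (hle : ∀ x ∈ Ω, ∃ A, ∀ᶠ n in l, f n x ≤ A)
    (hge : ∀ x ∈ D ∩ Ω, ∃ A, ∀ᶠ n in l, A ≤ f n x) {x : E} (hx : x ∈ Ω) :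
    ∃ A, ∀ᶠ n in l, A ≤ f n x := by
  -- `x` is reflected across a nearby point `y` of `D`, at which `f n` is bounded below.
  obtain ⟨y, ⟨hyΩ, hreflect⟩, hyD⟩ := hD.inter_open_nonempty
    (Ω ∩ (fun y => AffineMap.lineMap x y (2 : ℝ)) ⁻¹' Ω)
    (hΩ.inter (hΩ.preimage (by simp only [AffineMap.lineMap_apply]; fun_prop)))
    ⟨x, hx, by simpa using hx⟩
  obtain ⟨A, hA⟩ := hle _ hreflect
  obtain ⟨B, hB⟩ := hge y ⟨hyD, hyΩ⟩
  refine ⟨2 * B - A, ?_⟩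
  filter_upwards [hA, hB, hC x hx, hC _ hreflect] with n hAn hBn hxn hreflectn
  have hmid := (hf n).2 hxn hreflectn (show (0 : ℝ) ≤ 1 / 2 by norm_num)
    (show (0 : ℝ) ≤ 1 / 2 by norm_num) (by norm_num)
  have hy : (1 / 2 : ℝ) • x + (1 / 2 : ℝ) • AffineMap.lineMap x y (2 : ℝ) = y := by
    rw [AffineMap.lineMap_apply_module]
    module
  rw [hy] at hmid
  simp only [smul_eq_mul] at hmid
  linarith

theorem convexOn_limsup [l.NeBot] (hΩconvex : Convex ℝ Ω) (hf : ∀ n, ConvexOn ℝ (C n) (f n))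
    (hC : ∀ x ∈ Ω, ∀ᶠ n in l, x ∈ C n) (hle : ∀ x ∈ Ω, ∃ A, ∀ᶠ n in l, f n x ≤ A)
    (hge : ∀ x ∈ Ω, ∃ A, ∀ᶠ n in l, A ≤ f n x) :
    ConvexOn ℝ Ω fun x => limsup (fun n => f n x) l := by
  refine ⟨hΩconvex, fun x hx y hy a b ha hb hab => le_of_forall_pos_le_add fun ε hε => ?_⟩
  have hlt (z : E) (hz : z ∈ Ω) :
      ∀ᶠ n in l, f n z ≤ limsup (fun n => f n z) l + ε := by
    obtain ⟨A, hA⟩ := hle z hz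
    exact (eventually_lt_of_limsup_lt (lt_add_of_pos_right _ hε)
      (isBoundedUnder_of_eventually_le hA)).mono fun n => le_of_lt
  obtain ⟨B, hB⟩ := hge _ (hΩconvex hx hy ha hb hab)
  refine limsup_le_of_le (isBoundedUnder_of_eventually_ge hB).isCoboundedUnder_le ?_
  filter_upwards [eventually_convex_combination_le hf (hC x hx) (hC y hy) ha hb hab
    (hlt x hx) (hlt y hy)] with n hn
  refine hn.trans_eq ?_
  simp only [smul_eq_mul]
  linear_combination ε * hab

theorem exists_convexOn_eqOn_of_tendsto [FiniteDimensional ℝ E] [l.NeBot] (hΩ : IsOpen Ω)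
    (hΩconvex : Convex ℝ Ω) (hf : ∀ n, ConvexOn ℝ (C n) (f n))
    (hC : ∀ x ∈ Ω, ∀ᶠ n in l, x ∈ C n) (hD : Dense D) {u : E → ℝ}
    (hlim : ∀ x ∈ D ∩ Ω, Tendsto (fun n => f n x) l (𝓝 (u x))) :
    ∃ g, ConvexOn ℝ Ω g ∧ EqOn u g (D ∩ Ω) := by
  have hle (x) (hx : x ∈ Ω) : ∃ A, ∀ᶠ n in l, f n x ≤ A :=
    exists_eventually_le_of_dense hΩ hΩconvex hf hC hD
      (fun y hy => ⟨_, (hlim y hy).eventually_le_const (lt_add_one (u y))⟩) hx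
  have hge (x) (hx : x ∈ Ω) : ∃ A, ∀ᶠ n in l, A ≤ f n x :=
    exists_eventually_ge_of_dense hΩ hf hC hD hle
      (fun y hy => ⟨_, (hlim y hy).eventually_const_le (sub_one_lt (u y))⟩) hx
  exact ⟨_, convexOn_limsup hΩconvex hf hC hle hge, fun x hx => (hlim x hx).limsup_eq.symm⟩

end Limits

end Convexity

section HessianSign

variable {Ω : Set Plane} {s : Plane → ℝ} {H : Plane → Mat2}

/-- The value at `v` of the quadratic form with matrix `M`, as a continuous linear function of the
entries of `M`; this is what allows it to be exchanged with mollification. -/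
noncomputable def quadraticFormAt (v : Plane) : (Fin 2 → Fin 2 → ℝ) →L[ℝ] ℝ :=
  ∑ i, v i • (linearForm.flip v).comp (ContinuousLinearMap.proj i)

theorem quadraticFormAt_apply (v : Plane) (M : Fin 2 → Fin 2 → ℝ) :
    quadraticFormAt v M = v ⬝ᵥ fun i => linearForm (M i) v := by
  simp [quadraticFormAt, dotProduct]

theorem posSemidef_iff_quadraticFormAt_nonneg {M : Fin 2 → Fin 2 → ℝ}
    (hM : (Matrix.of M).IsHermitian) :
    (Matrix.of M).PosSemidef ↔ ∀ v, 0 ≤ quadraticFormAt v M := by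
  have hform (x : Fin 2 → ℝ) :
      quadraticFormAt (WithLp.toLp 2 x) M = star x ⬝ᵥ (Matrix.of M *ᵥ x) := by
    simp only [quadraticFormAt_apply, linearForm_apply, star_trivial]
    rfl
  rw [Matrix.posSemidef_iff_dotProduct_mulVec, and_iff_right hM]
  exact ⟨fun h v => hform v ▸ h v, fun h x => hform x ▸ h _⟩

theorem HasWeakHessian.fderiv_fderiv_mollify (h : HasWeakHessian Ω s H) (hs : MemW21 Ω s)
    (hΩ : IsOpen Ω) {ψ : ContDiffBump (0 : Plane)} {x : Plane} (hx : x ∈ innerPoints Ω ψ.rOut)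
    (v : Plane) :
    fderiv ℝ (fderiv ℝ (mollify volume ψ Ω s)) x v v =
      quadraticFormAt v (mollify volume ψ Ω (fun y i j => H y i j) x) := by
  have hHint := hs.integrableOn_hessian hΩ h
  obtain ⟨g, hg, hgH⟩ := h
  have hgint := hs.integrableOn_gradient hΩ hg
  have hgradient : fderiv ℝ (mollify volume ψ Ω s) =ᶠ[𝓝 x]
      fun z => linearForm (mollify volume ψ Ω g z) := by
    filter_upwards [(isOpen_innerPoints hΩ _).mem_nhds hx] with z hz using
      hg.fderiv_mollify hΩ.measurableSet hs.integrable hgint hz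
  have hrow (i : Fin 2) : fderiv ℝ (mollify volume ψ Ω g) x v i =
      linearForm (mollify volume ψ Ω (fun y i j => H y i j) x i) v := by
    have hmap := map_mollify volume ψ (ContinuousLinearMap.proj (R := ℝ) i) hΩ.measurableSet hHint x
    have hderiv := (hgH i).fderiv_mollify hΩ.measurableSet (hgint.eval i) (hHint.eval i) hx
    exact (map_fderiv_mollify volume ψ (ContinuousLinearMap.proj (R := ℝ) i) hΩ.measurableSet
      hgint x v).trans (DFunLike.congr_fun (hderiv.trans (congrArg linearForm hmap.symm)) v)
  rw [hgradient.fderiv_eq, fderiv_fun_comp x linearForm.differentiableAt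
    ((contDiff_mollify volume ψ hΩ.measurableSet hgint).differentiable (by simp) x),
    linearForm.fderiv, ContinuousLinearMap.comp_apply, linearForm_apply, quadraticFormAt_apply,
    dotProduct_comm, funext hrow]

theorem HasWeakHessian.ae_posSemidef (h : HasWeakHessian Ω s H) (hs : MemW21 Ω s)
    (hΩ : IsOpen Ω) (hconvex : ConvexOn ℝ Ω s) : ∀ᵐ x ∂volume.restrict Ω, (H x).PosSemidef := by
  have hHint := hs.integrableOn_hessian hΩ h
  filter_upwards [h.ae_isSymm hΩ, ae_tendsto_mollify volume hΩ.measurableSet hHint,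
    ae_restrict_mem hΩ.measurableSet] with x hsymm hlim hx
  refine (posSemidef_iff_quadraticFormAt_nonneg hsymm).2 fun v => ge_of_tendsto
    (((quadraticFormAt v).continuous.tendsto _).comp hlim) ?_
  filter_upwards [eventually_mem_innerPoints_bumpSeq hΩ hx] with n hn
  rw [Function.comp_apply, ← h.fderiv_fderiv_mollify hs hΩ hn]
  exact fderiv2_nonneg_of_convexOn (isOpen_innerPoints hΩ _)
    ((contDiff_mollify volume _ hΩ.measurableSet hs.integrable).of_le ENat.LEInfty.out)
    (convexOn_mollify volume _ hΩ.measurableSet hs.integrable hconvex) hn v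

theorem HasWeakHessian.exists_convexOn_ae_eq (h : HasWeakHessian Ω s H) (hs : MemW21 Ω s)
    (hΩ : IsOpen Ω) (hΩconvex : Convex ℝ Ω) (hpos : ∀ᵐ x ∂volume.restrict Ω, (H x).PosSemidef) :
    ∃ f, ConvexOn ℝ Ω f ∧ s =ᵐ[volume.restrict Ω] f := by
  have hHint := hs.integrableOn_hessian hΩ h
  have hmollify (n : ℕ) :
      ConvexOn ℝ (innerPoints Ω (bumpSeq n : ContDiffBump (0 : Plane)).rOut)
        (mollify volume (bumpSeq n) Ω s) := by
    refine convexOn_of_fderiv2_nonneg (convex_innerPoints hΩconvex _)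
      ((contDiff_mollify volume _ hΩ.measurableSet hs.integrable).of_le ENat.LEInfty.out)
      fun x hx v => ?_
    rw [h.fderiv_fderiv_mollify hs hΩ hx, map_mollify volume _ _ hΩ.measurableSet hHint]
    refine mollify_nonneg volume _ hΩ.measurableSet ?_ x
    filter_upwards [hpos] with y hy using (posSemidef_iff_quadraticFormAt_nonneg hy.1).1 hy v
  have hlim := (ae_restrict_iff' hΩ.measurableSet).1
    (ae_tendsto_mollify volume hΩ.measurableSet hs.integrable)
  obtain ⟨f, hf, hsf⟩ := exists_convexOn_eqOn_of_tendsto hΩ hΩconvex hmollify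
    (fun x hx => eventually_mem_innerPoints_bumpSeq hΩ hx) (Measure.dense_of_ae hlim)
    fun x hx => hx.1 hx.2
  refine ⟨f, hf, (ae_restrict_iff' hΩ.measurableSet).2 ?_⟩
  filter_upwards [hlim] with x hx hxΩ using hsf ⟨hx, hxΩ⟩

end HessianSign

section Segments

variable {E : Type*} [NormedAddCommGroup E] [NormedSpace ℝ E] [FiniteDimensional ℝ E]
  [MeasurableSpace E] [BorelSpace E] (μ : Measure E) [μ.IsAddHaarMeasure] {Ω A : Set E}

theorem addHaar_preimage_homothety_le (c : E) {t : ℝ} (ht : 1 / 2 ≤ t) (s : Set E) :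
    μ (AffineMap.homothety c t ⁻¹' s) ≤ 2 ^ Module.finrank ℝ E * μ s := by
  have hpow : 1 ≤ (2 : ℝ≥0∞) ^ Module.finrank ℝ E * ENNReal.ofReal |t ^ Module.finrank ℝ E| := by
    have h2t : 1 ≤ 2 * t := by linarith
    rw [abs_of_nonneg (by positivity), ← ENNReal.ofReal_ofNat 2,
      ← ENNReal.ofReal_pow (by norm_num), ← ENNReal.ofReal_mul (by positivity), ← mul_pow]
    exact ENNReal.one_le_ofReal.2 (one_le_pow₀ h2t)
  calc μ (AffineMap.homothety c t ⁻¹' s)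
      ≤ 2 ^ Module.finrank ℝ E * ENNReal.ofReal |t ^ Module.finrank ℝ E| *
          μ (AffineMap.homothety c t ⁻¹' s) := le_mul_of_one_le_left' hpow
    _ = 2 ^ Module.finrank ℝ E *
          μ (AffineMap.homothety c t '' (AffineMap.homothety c t ⁻¹' s)) := by
        rw [Measure.addHaar_image_homothety, mul_assoc]
    _ ≤ 2 ^ Module.finrank ℝ E * μ s := by
        gcongr
        exact image_preimage_subset _ _

theorem restrict_preimage_homothety_le (hconvex : Convex ℝ Ω) (hAΩ : A ⊆ Ω)
    {c : E} (hc : c ∈ Ω) {t : ℝ} (ht : t ∈ Icc (1 / 2) 1) {s : Set E} (hs : MeasurableSet s) :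
    μ.restrict A (AffineMap.homothety c t ⁻¹' s) ≤
      2 ^ Module.finrank ℝ E * μ.restrict Ω s := by
  have hmaps : AffineMap.homothety c t ⁻¹' s ∩ A ⊆ AffineMap.homothety c t ⁻¹' (s ∩ Ω) :=
    fun x hx => ⟨hx.1, by
      rw [AffineMap.homothety_eq_lineMap]
      exact hconvex.lineMap_mem hc (hAΩ hx.2) ⟨by linarith [ht.1], ht.2⟩⟩
  rw [Measure.restrict_apply hs, Measure.restrict_apply
    ((AffineMap.homothety_continuous c t).measurable hs)]
  exact (measure_mono hmaps).trans (addHaar_preimage_homothety_le μ c ht.1 _)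

/-- The product measure on the triples `((x, a), t) ∈ (Ω × A) × (0, 1]`, which parametrise the
points of the segments from `a ∈ A` to `x ∈ Ω`. -/
noncomputable abbrev segmentMeasure (Ω A : Set E) : Measure ((E × E) × ℝ) :=
  ((μ.restrict Ω).prod (μ.restrict A)).prod (volume.restrict (Ioc 0 1))

-- The point `a + t (x - a)` depends on `x` for `t ≥ 1 / 2`, on `a` for `t ≤ 1 / 2`, by a homothety
-- of ratio at least `1 / 2`.
theorem map_lineMap_segmentMeasure_le (hΩ : MeasurableSet Ω) (hA : MeasurableSet A)
    (hconvex : Convex ℝ Ω) (hAΩ : A ⊆ Ω) :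
    Measure.map (fun p => AffineMap.lineMap p.1.2 p.1.1 p.2) (segmentMeasure μ Ω A) ≤
      (2 ^ Module.finrank ℝ E * (μ A + μ Ω)) • μ.restrict Ω := by
  have hline : Continuous fun p : (E × E) × ℝ => AffineMap.lineMap (k := ℝ) p.1.2 p.1.1 p.2 := by
    fun_prop
  refine Measure.le_iff.2 fun s hs => ?_
  have hslice {t : ℝ} (ht : t ∈ Ioc (0 : ℝ) 1) :
      (μ.restrict Ω).prod (μ.restrict A) {q | AffineMap.lineMap q.2 q.1 t ∈ s} ≤
        2 ^ Module.finrank ℝ E * (μ A + μ Ω) * μ.restrict Ω s := by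
    have hmeas : MeasurableSet {q : E × E | AffineMap.lineMap q.2 q.1 t ∈ s} :=
      (hline.comp (Continuous.prodMk_left t)).measurable hs
    rcases le_total (1 / 2) t with h | h
    · calc (μ.restrict Ω).prod (μ.restrict A) {q | AffineMap.lineMap q.2 q.1 t ∈ s}
          ≤ ∫⁻ _ in A, 2 ^ Module.finrank ℝ E * μ.restrict Ω s ∂μ := by
            rw [Measure.prod_apply_symm hmeas]
            refine setLIntegral_mono' hA fun a ha => ?_
            simpa only [preimage, mem_ofPred_eq, AffineMap.homothety_eq_lineMap] using
              restrict_preimage_homothety_le μ hconvex Subset.rfl (hAΩ ha) ⟨h, ht.2⟩ hs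
        _ ≤ _ := by
            rw [setLIntegral_const, mul_right_comm]
            gcongr
            exact le_self_add
    · calc (μ.restrict Ω).prod (μ.restrict A) {q | AffineMap.lineMap q.2 q.1 t ∈ s}
          ≤ ∫⁻ _ in Ω, 2 ^ Module.finrank ℝ E * μ.restrict Ω s ∂μ := by
            rw [Measure.prod_apply hmeas]
            refine setLIntegral_mono' hΩ fun x hx => ?_
            simpa only [preimage, mem_ofPred_eq, AffineMap.homothety_eq_lineMap,
              AffineMap.lineMap_apply_one_sub] using
              restrict_preimage_homothety_le μ hconvex hAΩ hx
                (t := 1 - t) ⟨by linarith, by linarith [ht.1]⟩ hs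
        _ ≤ _ := by
            rw [setLIntegral_const, mul_right_comm]
            gcongr
            exact le_add_self
  rw [Measure.map_apply hline.measurable hs, Measure.prod_apply_symm (hline.measurable hs)]
  calc ∫⁻ t in Ioc (0 : ℝ) 1, (μ.restrict Ω).prod (μ.restrict A)
          {q | AffineMap.lineMap q.2 q.1 t ∈ s}
      ≤ ∫⁻ _ in Ioc (0 : ℝ) 1, 2 ^ Module.finrank ℝ E * (μ A + μ Ω) * μ.restrict Ω s :=
        setLIntegral_mono' measurableSet_Ioc fun t ht => hslice ht
    _ = ((2 ^ Module.finrank ℝ E * (μ A + μ Ω)) • μ.restrict Ω) s := by simp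

end Segments

section AveragedPrimitive

variable {E : Type*} [NormedAddCommGroup E] [NormedSpace ℝ E] [MeasurableSpace E]
  {F : Type*} [NormedAddCommGroup F] [NormedSpace ℝ F]

/-- The average over the starting points `a ∈ A` of the integrals of the one-form `η` along the
segments from `a` to `x`. Unlike the integral from a single starting point, it makes sense for
almost every `x` when `η` is merely integrable. -/
noncomputable def averagedPrimitive (μ : Measure E) (A : Set E) (η : E → E →L[ℝ] F) (x : E) : F :=
  ⨍ a in A, ∫ᶜ y in .segment a x, η y ∂μ

theorem hasFDerivAt_averagedPrimitive [BorelSpace E] [CompleteSpace F] {μ : Measure E}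
    [IsFiniteMeasureOnCompacts μ] {A U : Set E} {η : E → E →L[ℝ] F} (hUconvex : Convex ℝ U)
    (hU : IsOpen U) (hA : IsCompact A) (hμA : μ A ≠ 0) (hAU : A ⊆ U)
    (hη : DifferentiableOn ℝ η U)
    (hsymm : ∀ x ∈ U, ∀ v w, fderiv ℝ η x v w = fderiv ℝ η x w v) {x : E} (hx : x ∈ U) :
    HasFDerivAt (averagedPrimitive μ A η) (η x) x := by
  have hderiv : ∀ y ∈ U, HasFDerivWithinAt η (fderiv ℝ η y) U y := fun y hy =>
    (hη.differentiableAt (hU.mem_nhds hy)).hasFDerivAt.hasFDerivWithinAt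
  have hclosed : ∀ y ∈ U, ∀ v ∈ tangentConeAt ℝ U y, ∀ w ∈ tangentConeAt ℝ U y,
      fderiv ℝ η y v w = fderiv ℝ η y w v := fun y hy v _ w _ => hsymm y hy v w
  let f : E → F := fun y => ∫ᶜ z in .segment x y, η z
  have hf : ∀ y ∈ U, HasFDerivAt f (η y) y := fun y hy =>
    (hUconvex.hasFDerivWithinAt_curveIntegral_segment_of_hasFDerivWithinAt_symmetric hderiv hclosed
      hx hy).hasFDerivAt (hU.mem_nhds hy)
  have hfint : IntegrableOn f A μ := ContinuousOn.integrableOn_compact hA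
    fun y hy => (hf y (hAU hy)).continuousAt.continuousWithinAt
  have hconst (c : F) : ⨍ _ in A, c ∂μ = c := setAverage_const hμA hA.measure_lt_top.ne c
  have hsub : ∀ y ∈ U, averagedPrimitive μ A η y = f y - ⨍ a in A, f a ∂μ := fun y hy => calc
    averagedPrimitive μ A η y = ⨍ a in A, (f y - f a) ∂μ := by
      refine setAverage_congr_fun hA.measurableSet (Eventually.of_forall fun a ha => ?_)
      exact eq_sub_of_add_eq' <|
        hUconvex.curveIntegral_segment_add_eq_of_hasFDerivWithinAt_symmetric hderiv hclosed
          hx (hAU ha) hy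
    _ = f y - ⨍ a in A, f a ∂μ := by
      have hyint : IntegrableOn (fun _ => f y) A μ := integrableOn_const hA.measure_lt_top.ne
      rw [setAverage_eq, integral_sub hyint hfint, smul_sub, ← setAverage_eq, ← setAverage_eq,
        hconst]
  exact ((hf x hx).sub_const _).congr_of_eventuallyEq
    (eventually_of_mem (hU.mem_nhds hx) hsub)

variable [FiniteDimensional ℝ E] (μ : Measure E) [μ.IsAddHaarMeasure] {Ω A : Set E}
  {η η' : E → E →L[ℝ] F}

/-- The constant bounding integrals along the segments from `A` to `Ω`, in the `L¹(Ω × A)` norm, by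
the `L¹(Ω)` norm of the integrand. -/
noncomputable def segmentBound (μ : Measure E) (Ω A : Set E) : ℝ≥0∞ :=
  ediam Ω * (2 ^ Module.finrank ℝ E * (μ A + μ Ω))

theorem segmentBound_ne_top (hbounded : Bornology.IsBounded Ω) (hAΩ : A ⊆ Ω) :
    segmentBound μ Ω A ≠ ⊤ := by
  have hμΩ : μ Ω ≠ ⊤ := hbounded.measure_lt_top.ne
  have hμA : μ A ≠ ⊤ := measure_ne_top_of_subset hAΩ hμΩ
  have hdiam : ediam Ω ≠ ⊤ := hbounded.ediam_ne_top
  rw [segmentBound]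
  finiteness

variable [BorelSpace E]

theorem aestronglyMeasurable_segment (hΩ : MeasurableSet Ω) (hA : MeasurableSet A)
    (hconvex : Convex ℝ Ω) (hAΩ : A ⊆ Ω)
    (hη : AEStronglyMeasurable η (μ.restrict Ω)) :
    AEStronglyMeasurable (fun p : (E × E) × ℝ =>
      η (AffineMap.lineMap p.1.2 p.1.1 p.2) (p.1.1 - p.1.2)) (segmentMeasure μ Ω A) := by
  have hline : Continuous fun p : (E × E) × ℝ => AffineMap.lineMap (k := ℝ) p.1.2 p.1.1 p.2 := by
    fun_prop
  have hcomp := ((hη.smul_measure _).mono_measure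
    (map_lineMap_segmentMeasure_le μ hΩ hA hconvex hAΩ)).comp_measurable hline.measurable
  have hsub : Continuous fun p : (E × E) × ℝ => p.1.1 - p.1.2 := by fun_prop
  exact (ContinuousLinearMap.apply ℝ F).aestronglyMeasurable_comp₂ hsub.aestronglyMeasurable hcomp

theorem lintegral_enorm_segment_le (hΩ : MeasurableSet Ω) (hA : MeasurableSet A)
    (hconvex : Convex ℝ Ω) (hAΩ : A ⊆ Ω)
    (hη : AEStronglyMeasurable η (μ.restrict Ω)) :
    ∫⁻ p, ‖η (AffineMap.lineMap p.1.2 p.1.1 p.2) (p.1.1 - p.1.2)‖ₑ ∂segmentMeasure μ Ω A ≤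
      segmentBound μ Ω A * ∫⁻ x in Ω, ‖η x‖ₑ ∂μ := by
  have hline : Continuous fun p : (E × E) × ℝ => AffineMap.lineMap (k := ℝ) p.1.2 p.1.1 p.2 := by
    fun_prop
  have hmap := map_lineMap_segmentMeasure_le μ hΩ hA hconvex hAΩ
  have hmem : ∀ᵐ p ∂segmentMeasure μ Ω A, p.1 ∈ Ω ×ˢ A := by
    refine Measure.quasiMeasurePreserving_fst.ae ?_
    rw [Measure.prod_restrict]
    exact ae_restrict_mem (hΩ.prod hA)
  calc ∫⁻ p, ‖η (AffineMap.lineMap p.1.2 p.1.1 p.2) (p.1.1 - p.1.2)‖ₑ ∂segmentMeasure μ Ω A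
      ≤ ∫⁻ p, ediam Ω * ‖η (AffineMap.lineMap p.1.2 p.1.1 p.2)‖ₑ ∂segmentMeasure μ Ω A := by
        refine lintegral_mono_ae (hmem.mono fun p hp => ?_)
        rw [mul_comm]
        refine (ContinuousLinearMap.le_opENorm _ _).trans ?_
        gcongr
        rw [← edist_eq_enorm_sub]
        exact edist_le_ediam_of_mem hp.1 (hAΩ hp.2)
    _ = ediam Ω * ∫⁻ x, ‖η x‖ₑ
          ∂Measure.map (fun p => AffineMap.lineMap p.1.2 p.1.1 p.2) (segmentMeasure μ Ω A) := by
        have hη' := ((hη.smul_measure _).mono_measure hmap).enorm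
        rw [lintegral_map' hη' hline.aemeasurable, lintegral_const_mul'']
        exact hη'.comp_aemeasurable hline.aemeasurable
    _ ≤ ediam Ω * ∫⁻ x, ‖η x‖ₑ ∂((2 ^ Module.finrank ℝ E * (μ A + μ Ω)) • μ.restrict Ω) := by
        gcongr
    _ = segmentBound μ Ω A * ∫⁻ x in Ω, ‖η x‖ₑ ∂μ := by
        rw [lintegral_smul_measure, smul_eq_mul, segmentBound]
        ring

theorem integrable_segment (hΩ : MeasurableSet Ω) (hA : MeasurableSet A)
    (hconvex : Convex ℝ Ω) (hAΩ : A ⊆ Ω)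
    (hbounded : Bornology.IsBounded Ω) (hη : IntegrableOn η Ω μ) :
    Integrable (fun p : (E × E) × ℝ =>
      η (AffineMap.lineMap p.1.2 p.1.1 p.2) (p.1.1 - p.1.2)) (segmentMeasure μ Ω A) := by
  refine ⟨aestronglyMeasurable_segment μ hΩ hA hconvex hAΩ hη.1,
    (lintegral_enorm_segment_le μ hΩ hA hconvex hAΩ hη.1).trans_lt ?_⟩
  exact ENNReal.mul_lt_top (segmentBound_ne_top μ hbounded hAΩ).lt_top hη.2

theorem integrable_curveIntegral_segment (hΩ : MeasurableSet Ω) (hA : MeasurableSet A)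
    (hconvex : Convex ℝ Ω) (hAΩ : A ⊆ Ω)
    (hbounded : Bornology.IsBounded Ω) (hη : IntegrableOn η Ω μ) :
    Integrable (fun q : E × E => ∫ᶜ y in .segment q.2 q.1, η y)
      ((μ.restrict Ω).prod (μ.restrict A)) := by
  simp only [curveIntegral_segment, intervalIntegral.integral_of_le zero_le_one]
  exact (integrable_segment μ hΩ hA hconvex hAΩ hbounded hη).integral_prod_left

theorem ae_curveIntegrable_segment (hΩ : MeasurableSet Ω) (hA : MeasurableSet A)
    (hconvex : Convex ℝ Ω) (hAΩ : A ⊆ Ω)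
    (hbounded : Bornology.IsBounded Ω) (hη : IntegrableOn η Ω μ) :
    ∀ᵐ x ∂μ.restrict Ω, ∀ᵐ a ∂μ.restrict A, CurveIntegrable η (.segment a x) := by
  simp only [curveIntegrable_segment, intervalIntegrable_iff_integrableOn_Ioc_of_le zero_le_one]
  exact Measure.ae_ae_of_ae_prod (integrable_segment μ hΩ hA hconvex hAΩ hbounded hη).prod_right_ae

theorem integrableOn_averagedPrimitive (hΩ : MeasurableSet Ω) (hA : MeasurableSet A)
    (hconvex : Convex ℝ Ω) (hAΩ : A ⊆ Ω)
    (hbounded : Bornology.IsBounded Ω) (hη : IntegrableOn η Ω μ) :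
    IntegrableOn (averagedPrimitive μ A η) Ω μ := by
  unfold averagedPrimitive
  simp only [setAverage_eq]
  exact (integrable_curveIntegral_segment μ hΩ hA hconvex hAΩ hbounded hη).integral_prod_left.smul _

theorem averagedPrimitive_sub_ae_eq (hΩ : MeasurableSet Ω) (hA : MeasurableSet A)
    (hconvex : Convex ℝ Ω) (hAΩ : A ⊆ Ω)
    (hbounded : Bornology.IsBounded Ω) (hη : IntegrableOn η Ω μ) (hη' : IntegrableOn η' Ω μ) :
    (averagedPrimitive μ A fun x => η x - η' x) =ᵐ[μ.restrict Ω]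
      fun x => averagedPrimitive μ A η x - averagedPrimitive μ A η' x := by
  filter_upwards [ae_curveIntegrable_segment μ hΩ hA hconvex hAΩ hbounded hη,
    ae_curveIntegrable_segment μ hΩ hA hconvex hAΩ hbounded hη',
    (integrable_curveIntegral_segment μ hΩ hA hconvex hAΩ hbounded hη).prod_right_ae,
    (integrable_curveIntegral_segment μ hΩ hA hconvex hAΩ hbounded hη').prod_right_ae]
    with x hx hx' hint hint'
  simp only [averagedPrimitive, setAverage_eq]
  rw [← smul_sub, ← integral_sub hint hint']
  congr 1
  refine integral_congr_ae ?_
  filter_upwards [hx, hx'] with a ha ha' using curveIntegral_fun_sub ha ha'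

theorem lintegral_enorm_averagedPrimitive_le (hΩ : MeasurableSet Ω) (hA : MeasurableSet A)
    (hconvex : Convex ℝ Ω) (hAΩ : A ⊆ Ω)
    (hη : AEStronglyMeasurable η (μ.restrict Ω)) :
    ∫⁻ x in Ω, ‖averagedPrimitive μ A η x‖ₑ ∂μ ≤
      ‖(μ.real A)⁻¹‖ₑ * (segmentBound μ Ω A * ∫⁻ x in Ω, ‖η x‖ₑ ∂μ) := by
  have hmeas := aestronglyMeasurable_segment μ hΩ hA hconvex hAΩ hη
  calc ∫⁻ x in Ω, ‖averagedPrimitive μ A η x‖ₑ ∂μ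
      = ‖(μ.real A)⁻¹‖ₑ * ∫⁻ x in Ω, ‖∫ a in A, ∫ᶜ y in .segment a x, η y ∂μ‖ₑ ∂μ := by
        simp only [averagedPrimitive, setAverage_eq, enorm_smul]
        exact lintegral_const_mul' _ _ enorm_ne_top
    _ ≤ ‖(μ.real A)⁻¹‖ₑ * ∫⁻ x in Ω, ∫⁻ a in A,
          (∫⁻ t in Ioc (0 : ℝ) 1, ‖η (AffineMap.lineMap a x t) (x - a)‖ₑ) ∂μ ∂μ := by
        gcongr with x
        refine (enorm_integral_le_lintegral_enorm _).trans (lintegral_mono fun a => ?_)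
        rw [curveIntegral_segment, intervalIntegral.integral_of_le zero_le_one]
        exact enorm_integral_le_lintegral_enorm _
    _ = ‖(μ.real A)⁻¹‖ₑ * ∫⁻ p, ‖η (AffineMap.lineMap p.1.2 p.1.1 p.2) (p.1.1 - p.1.2)‖ₑ
          ∂segmentMeasure μ Ω A := by
        rw [lintegral_prod _ hmeas.enorm, lintegral_prod _ hmeas.enorm.lintegral_prod_right']
    _ ≤ _ := by
        gcongr
        exact lintegral_enorm_segment_le μ hΩ hA hconvex hAΩ hη

theorem tendsto_lintegral_enorm_averagedPrimitive_sub {ι : Type*} {l : Filter ι}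
    {η : ι → E → E →L[ℝ] F} (hΩ : MeasurableSet Ω) (hA : MeasurableSet A)
    (hconvex : Convex ℝ Ω) (hAΩ : A ⊆ Ω) (hbounded : Bornology.IsBounded Ω)
    (hη : ∀ n, IntegrableOn (η n) Ω μ) (hη' : IntegrableOn η' Ω μ)
    (hlim : Tendsto (fun n => ∫⁻ x in Ω, ‖η n x - η' x‖ₑ ∂μ) l (𝓝 0)) :
    Tendsto (fun n => ∫⁻ x in Ω, ‖averagedPrimitive μ A (η n) x - averagedPrimitive μ A η' x‖ₑ ∂μ)
      l (𝓝 0) := by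
  have hbound : Tendsto (fun n => ‖(μ.real A)⁻¹‖ₑ *
      (segmentBound μ Ω A * ∫⁻ x in Ω, ‖η n x - η' x‖ₑ ∂μ)) l (𝓝 0) := by
    simpa only [mul_zero] using ENNReal.Tendsto.const_mul (ENNReal.Tendsto.const_mul hlim
      (Or.inr (segmentBound_ne_top μ hbounded hAΩ))) (Or.inr enorm_ne_top)
  refine tendsto_of_tendsto_of_tendsto_of_le_of_le tendsto_const_nhds hbound (fun _ => zero_le)
    fun n => ?_
  refine le_of_eq_of_le (lintegral_congr_ae ?_)
    (lintegral_enorm_averagedPrimitive_le μ hΩ hA hconvex hAΩ ((hη n).sub hη').1)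
  filter_upwards [averagedPrimitive_sub_ae_eq μ hΩ hA hconvex hAΩ hbounded (hη n) hη'] with x hx
  exact congrArg enorm hx.symm

end AveragedPrimitive

theorem tendsto_lintegral_enorm_map_sub {X V W ι : Type*} {m : MeasurableSpace X}
    [NormedAddCommGroup V] [NormedSpace ℝ V] [NormedAddCommGroup W] [NormedSpace ℝ W]
    {μ : Measure X} {l : Filter ι} (L : V →L[ℝ] W) {u : ι → X → V} {v : X → V}
    (h : Tendsto (fun n => ∫⁻ x, ‖u n x - v x‖ₑ ∂μ) l (𝓝 0)) :
    Tendsto (fun n => ∫⁻ x, ‖L (u n x) - L (v x)‖ₑ ∂μ) l (𝓝 0) := by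
  have hlim := ENNReal.Tendsto.const_mul (a := ‖L‖ₑ) h (.inr enorm_ne_top)
  rw [mul_zero] at hlim
  refine tendsto_of_tendsto_of_tendsto_of_le_of_le tendsto_const_nhds hlim (fun _ => zero_le)
    fun n => ?_
  simp only [← map_sub]
  rw [← lintegral_const_mul' _ _ enorm_ne_top]
  exact lintegral_mono fun x => L.le_opENorm _

theorem IsCurlFree.hasWeakGradient_averagedPrimitive_mollify {Ω A : Set Plane}
    {F : Plane → Fin 2 → ℝ} {δ : ℝ} {φ : ContDiffBump (0 : Plane)} (h : IsCurlFree Ω F)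
    (hΩ : IsOpen Ω) (hconvex : Convex ℝ Ω) (hF : IntegrableOn F Ω) (hA : IsCompact A)
    (hvolA : volume A ≠ 0) (hAδ : A ⊆ innerPoints Ω δ) (hφ : φ.rOut ≤ δ) :
    HasWeakGradient (innerPoints Ω δ)
      (averagedPrimitive volume A fun x => linearForm (mollify volume φ Ω F x))
      (mollify volume φ Ω F) := by
  have hm := hΩ.measurableSet
  have hG : ContDiff ℝ ∞ (mollify volume φ Ω F) := contDiff_mollify volume φ hm hF
  have hform : Differentiable ℝ fun x => linearForm (mollify volume φ Ω F x) :=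
    linearForm.differentiable.comp (hG.differentiable (by simp))
  refine hasWeakGradient_of_hasFDerivAt (isOpen_innerPoints hΩ δ) (fun x hx => ?_)
    hG.continuous.continuousOn
  exact hasFDerivAt_averagedPrimitive (convex_innerPoints hconvex δ) (isOpen_innerPoints hΩ δ)
    hA hvolA hAδ hform.differentiableOn
    (fun x hx => h.fderiv_mollify_comm hm hF (innerPoints_antitone Ω hφ hx)) hx

theorem IsCurlFree.exists_hasWeakGradient {Ω : Set Plane} {F : Plane → Fin 2 → ℝ}
    (h : IsCurlFree Ω F) (hΩ : IsOpen Ω) (hconvex : Convex ℝ Ω)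
    (hbounded : Bornology.IsBounded Ω) (hF : IntegrableOn F Ω) :
    ∃ u, IntegrableOn u Ω ∧ HasWeakGradient Ω u F := by
  rcases Ω.eq_empty_or_nonempty with rfl | ⟨a, ha⟩
  · exact ⟨0, integrableOn_empty, fun i => ⟨by simp [LocallyIntegrableOn],
      by simp [LocallyIntegrableOn], fun φ _ => by simp⟩⟩
  obtain ⟨r, hr, hball⟩ := nhds_basis_closedBall.mem_iff.1 (hΩ.mem_nhds ha)
  have hm := hΩ.measurableSet
  have hA : MeasurableSet (closedBall a r) := measurableSet_closedBall
  have hvolA : volume (closedBall a r) ≠ 0 := (measure_closedBall_pos volume a hr).ne'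
  have hG (n : ℕ) : IntegrableOn (mollify volume (bumpSeq n) Ω F) Ω :=
    (integrable_mollify volume _ hm hF).integrableOn
  have hlim := tendsto_lintegral_enorm_mollify_sub volume hm hF
  have hform {w : Plane → Fin 2 → ℝ} (hw : IntegrableOn w Ω volume) :
      IntegrableOn (fun x => linearForm (w x)) Ω :=
    linearForm.integrable_comp hw
  have hint {w : Plane → Fin 2 → ℝ} (hw : IntegrableOn w Ω volume) :=
    integrableOn_averagedPrimitive volume hm hA hconvex hball hbounded (hform hw)
  refine ⟨_, hint hF, fun i => HasWeakPartial.of_tendsto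
    (U := fun n => averagedPrimitive volume (closedBall a r) fun x =>
      linearForm (mollify volume (bumpSeq n) Ω F x))
    (V := fun n x => mollify volume (bumpSeq n) Ω F x i)
    (hint hF) (hF.eval i) (fun n => hint (hG n)) (fun n => (hG n).eval i)
    (tendsto_lintegral_enorm_averagedPrimitive_sub volume hm hA hconvex hball hbounded
      (fun n => hform (hG n)) (hform hF) (tendsto_lintegral_enorm_map_sub linearForm hlim))
    (tendsto_lintegral_enorm_map_sub (.proj (R := ℝ) (φ := fun _ => ℝ) i) hlim)
    fun φ hφ => ?_⟩
  obtain ⟨δ, hδ, hδΩ⟩ := exists_subset_innerPoints hΩ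
    (hφ.hasCompactSupport.isCompact.union (isCompact_closedBall a r))
    (union_subset hφ.tsupport_subset hball)
  filter_upwards [(tendsto_bumpSeq_rOut (E := Plane)).eventually (gt_mem_nhds hδ)] with n hn
  have hφδ : IsTestFunction (innerPoints Ω δ) φ :=
    ⟨hφ.smooth, hφ.hasCompactSupport, subset_union_left.trans hδΩ⟩
  have hgrad := h.hasWeakGradient_averagedPrimitive_mollify hΩ hconvex hF
    (isCompact_closedBall a r) hvolA (subset_union_right.trans hδΩ) hn.le
  exact (hgrad i).integral_eq_of_subset hm (innerPoints_subset Ω hδ.le) hφδ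

theorem exists_hasWeakHessian {Ω : Set Plane} {H : Plane → Mat2} (hΩ : IsOpen Ω)
    (hconvex : Convex ℝ Ω) (hbounded : Bornology.IsBounded Ω)
    (hH : IntegrableOn (fun x i j => H x i j) Ω)
    (hsymm : ∀ᵐ x ∂volume.restrict Ω, (H x).IsSymm)
    (hcurl : ∀ i, IsCurlFree Ω fun x => H x i) :
    ∃ s, MemW21 Ω s ∧ HasWeakHessian Ω s H := by
  choose g hg hgH using fun i =>
    (hcurl i).exists_hasWeakGradient hΩ hconvex hbounded (hH.eval i)
  have hcurl_g : IsCurlFree Ω fun x i => g i x := fun φ hφ i j => by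
    rw [(hgH i j).integral_eq φ hφ, (hgH j i).integral_eq φ hφ]
    congr 1
    exact integral_congr_ae (by filter_upwards [hsymm] with x hx; rw [hx.apply])
  obtain ⟨s, hs, hsg⟩ := hcurl_g.exists_hasWeakGradient hΩ hconvex hbounded (.of_eval hg)
  exact ⟨s, ⟨hs, ⟨_, hsg, hg⟩, H, ⟨_, hsg, hgH⟩, fun i j => (hH.eval i).eval j⟩, _, hsg, hgH⟩

theorem isCurlFree_iff {Ω : Set Plane} {F : Plane → Fin 2 → ℝ} :
    IsCurlFree Ω F ↔ ∀ φ, IsTestFunction Ω φ →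
      ∫ x in Ω, F x 0 * partialDeriv 1 φ x = ∫ x in Ω, F x 1 * partialDeriv 0 φ x :=
  forall₂_congr fun φ _ => by simpa [Fin.forall_fin_two] using Eq.symm

section Rotation

variable {M : Mat2} {Ω : Set Plane} {Q : Plane → Mat2}

theorem rotR_transpose_mul_self : rotRᵀ * rotR = 1 := by
  ext i j
  fin_cases i <;> fin_cases j <;> simp [rotR, Matrix.mul_apply, Fin.sum_univ_two]

theorem rotR_mul_transpose_self : rotR * rotRᵀ = 1 :=
  mul_eq_one_comm.1 rotR_transpose_mul_self

theorem rotR_conj_eq (M : Mat2) :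
    rotRᵀ * M * rotR = !![M 1 1, -M 1 0; -M 0 1, M 0 0] := by
  ext i j
  fin_cases i <;> fin_cases j <;> simp [rotR, Matrix.mul_apply, Fin.sum_univ_two]

theorem rotR_conj_injective : Function.Injective fun M : Mat2 => rotRᵀ * M * rotR := fun M N h => by
  simpa [rotR_conj_eq, ← Matrix.ext_iff, and_comm, and_assoc, and_left_comm] using h

theorem rotR_conj_rotR_conj_transpose (M : Mat2) : rotRᵀ * (rotR * M * rotRᵀ) * rotR = M := by
  simp only [mul_assoc, rotR_transpose_mul_self, mul_one]
  rw [← mul_assoc, rotR_transpose_mul_self, one_mul]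

theorem det_rotR_conj (M : Mat2) : (rotRᵀ * M * rotR).det = M.det :=
  Matrix.det_conj_of_mul_eq_one rotR_transpose_mul_self rotR_mul_transpose_self

theorem posDef_rotR_conj_iff : (rotRᵀ * M * rotR).PosDef ↔ M.PosDef := by
  have h := Matrix.IsUnit.posDef_star_left_conjugate_iff (x := M)
    (IsUnit.of_mul_eq_one _ rotR_mul_transpose_self)
  rwa [Matrix.star_eq_conjTranspose, Matrix.conjTranspose_eq_transpose_of_trivial] at h

theorem integrableOn_rotR_conj_iff :
    IntegrableOn (fun x i j => (rotRᵀ * Q x * rotR) i j) Ω ↔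
      ∀ i j, IntegrableOn (fun x => Q x i j) Ω := by
  simp only [IntegrableOn, integrable_pi_iff, Fin.forall_fin_two, rotR_conj_eq, Matrix.of_apply,
    Matrix.cons_val_zero, Matrix.cons_val_one, Matrix.cons_val_fin_one, integrable_fun_neg_iff]
  tauto

theorem isDivergenceFree_iff_forall_column
    (hQ : ∀ i j, LocallyIntegrableOn (fun x => Q x i j) Ω) :
    IsDivergenceFree Ω Q ↔ ∀ φ, IsTestFunction Ω φ → ∀ j,
      ∑ i, ∫ x in Ω, Q x i j * partialDeriv i φ x = 0 := by
  refine forall₂_congr fun φ hφ => ?_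
  have hint (i j : Fin 2) : IntegrableOn (fun x => Q x i j * partialDeriv i φ x) Ω :=
    ((hφ.partialDeriv i).integrable_mul (hQ i j)).integrableOn
  have hsum (l : Fin 2 → ℝ) : ∫ x in Ω, (fun i => partialDeriv i φ x) ⬝ᵥ (Q x *ᵥ l) =
      ∑ j, l j * ∑ i, ∫ x in Ω, Q x i j * partialDeriv i φ x := by
    simp_rw [← integral_finsetSum _ fun i _ => hint i _, ← integral_const_mul]
    rw [← integral_finsetSum _ fun j _ =>
      (integrable_finsetSum _ fun i _ => hint i j).const_mul (l j)]
    congr 1 with x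
    simp only [dotProduct, Matrix.mulVec, Fin.sum_univ_two]
    ring
  simp only [hsum]
  refine ⟨fun h j => by simpa [Pi.single_apply] using h (Pi.single j 1), fun h l => by simp [h]⟩

theorem isDivergenceFree_iff_isCurlFree_rotR_conj
    (hQ : ∀ i j, LocallyIntegrableOn (fun x => Q x i j) Ω) :
    IsDivergenceFree Ω Q ↔ ∀ j, IsCurlFree Ω fun x => (rotRᵀ * Q x * rotR)ᵀ j := by
  rw [isDivergenceFree_iff_forall_column hQ]
  simp only [isCurlFree_iff, Fin.forall_fin_two, ← forall_and, Fin.sum_univ_two]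
  refine forall₂_congr fun φ hφ => ?_
  simp only [rotR_conj_eq, Matrix.transpose_apply, Matrix.of_apply, Matrix.cons_val_zero,
    Matrix.cons_val_one, Matrix.cons_val_fin_one, neg_mul, integral_neg]
  constructor <;> rintro ⟨h₀, h₁⟩ <;> constructor <;> linarith

end Rotation

theorem HasWeakHessian.posDef_of_detBounded {Ω : Set Plane} {s : Plane → ℝ} {H : Plane → Mat2}
    (h : HasWeakHessian Ω s H) (hs : MemW21 Ω s) (hΩ : IsOpen Ω) (hconvex : ConvexOn ℝ Ω s)
    (hdet : DetBounded Ω H) : ∀ᵐ x ∂volume.restrict Ω, (H x).PosDef := by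
  obtain ⟨c, _, hc, hdet⟩ := hdet
  filter_upwards [h.ae_posSemidef hs hΩ hconvex, hdet] with x hx hdetx
  exact hx.posDef_iff_det_ne_zero.2 (hc.trans_le hdetx.1).ne'

theorem IsConvexPotential.exists_conductivity {Ω : Set Plane} {s : Plane → ℝ}
    (h : IsConvexPotential Ω s) (hΩ : IsOpen Ω) :
    ∃ Q, IsDivFreeConductivity Ω Q ∧ HasWeakHessian Ω s fun x => rotRᵀ * Q x * rotR := by
  obtain ⟨H, hH, hdet⟩ := h.detBounded
  let Q : Plane → Mat2 := fun x => rotR * H x * rotRᵀ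
  have hQH : (fun x => rotRᵀ * Q x * rotR) = H := funext fun x => rotR_conj_rotR_conj_transpose _
  have hint : ∀ i j, IntegrableOn (fun x => Q x i j) Ω :=
    integrableOn_rotR_conj_iff.1 (hQH ▸ h.memW21.integrableOn_hessian hΩ hH)
  refine ⟨Q, ⟨hint, ?_, ?_, ?_⟩, hQH ▸ hH⟩
  · filter_upwards [hH.posDef_of_detBounded h.memW21 hΩ h.convexOn hdet] with x hx
    rwa [← posDef_rotR_conj_iff, rotR_conj_rotR_conj_transpose]
  · refine (isDivergenceFree_iff_isCurlFree_rotR_conj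
      fun i j => (hint i j).locallyIntegrableOn).2 fun j => ?_
    obtain ⟨g, -, hgH⟩ := id hH
    refine (hgH j).isCurlFree.congr ?_
    filter_upwards [hH.ae_isSymm hΩ] with x hx
    rw [rotR_conj_rotR_conj_transpose, hx]
  · simpa only [DetBounded, ← det_rotR_conj (Q _), Q, rotR_conj_rotR_conj_transpose] using hdet

theorem IsDivFreeConductivity.exists_potential {Ω : Set Plane} {Q : Plane → Mat2}
    (h : IsDivFreeConductivity Ω Q) (hΩ : IsOpen Ω) (hconvex : Convex ℝ Ω)
    (hbounded : Bornology.IsBounded Ω) :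
    ∃ s, IsConvexPotential Ω s ∧ HasWeakHessian Ω s fun x => rotRᵀ * Q x * rotR := by
  have hpos : ∀ᵐ x ∂volume.restrict Ω, (rotRᵀ * Q x * rotR).PosDef :=
    h.posDef.mono fun x hx => posDef_rotR_conj_iff.2 hx
  have hsymm : ∀ᵐ x ∂volume.restrict Ω, (rotRᵀ * Q x * rotR).IsSymm :=
    hpos.mono fun x hx => hx.isHermitian
  have hcurl := (isDivergenceFree_iff_isCurlFree_rotR_conj
    fun i j => (h.integrable i j).locallyIntegrableOn).1 h.divergenceFree
  obtain ⟨s, hs, hH⟩ := exists_hasWeakHessian hΩ hconvex hbounded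
    (integrableOn_rotR_conj_iff.2 h.integrable) hsymm fun i =>
      (hcurl i).congr (hsymm.mono fun x hx => congrFun hx i)
  obtain ⟨f, hf, hsf⟩ :=
    hH.exists_convexOn_ae_eq hs hΩ hconvex (hpos.mono fun x hx => hx.posSemidef)
  have hfH := hH.congr hsf EventuallyEq.rfl
  refine ⟨f, ⟨hf, hs.congr hsf, _, hfH, ?_⟩, hfH⟩
  simpa only [DetBounded, det_rotR_conj] using h.detBounded

theorem IsConvexPotential.exists_affineMap {Ω : Set Plane} {s s' : Plane → ℝ} {H : Plane → Mat2}
    (hs : IsConvexPotential Ω s) (hs' : IsConvexPotential Ω s') (hΩ : IsOpen Ω)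
    (hbounded : Bornology.IsBounded Ω) (h : HasWeakHessian Ω s H) (h' : HasWeakHessian Ω s' H) :
    ∃ a : Plane →ᵃ[ℝ] ℝ, ∀ x ∈ Ω, s x - s' x = a x := by
  obtain ⟨g, hg, hgH⟩ := h
  obtain ⟨g', hg', hgH'⟩ := h'
  have hzero (i : Fin 2) : HasWeakGradient Ω (fun x => g x i - g' x i) 0 := fun j =>
    ((hgH i j).sub (hgH' i j)).congr EventuallyEq.rfl (by simp)
  obtain ⟨a, ha⟩ := exists_affineMap_ae_eq hΩ hs.convexOn.1 hbounded
    (hs.memW21.integrable.sub hs'.memW21.integrable)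
    ((hs.memW21.integrableOn_gradient hΩ hg).sub (hs'.memW21.integrableOn_gradient hΩ hg'))
    (fun i => (hg i).sub (hg' i)) hzero
  exact ⟨a, Measure.eqOn_open_of_ae_eq ha hΩ
    ((hs.convexOn.continuousOn hΩ).sub (hs'.convexOn.continuousOn hΩ))
    a.continuous_of_finiteDimensional.continuousOn⟩

theorem exists_bijective_quotient_of_rel {α β : Type*} (r : Setoid α) (s : Setoid β)
    {R : α → β → Prop} (hleft : ∀ a, ∃ b, R a b) (hright : ∀ b, ∃ a, R a b)
    (hr : ∀ {a a' b}, R a b → (R a' b ↔ r a a')) (hs : ∀ {a b b'}, R a b → (R a b' ↔ s b b')) :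
    ∃ T : Quotient r → Quotient s, T.Bijective ∧
      ∀ a b, T (Quotient.mk r a) = Quotient.mk s b ↔ R a b := by
  choose f hf using hleft
  have hlift (a a' : α) (h : r a a') : Quotient.mk s (f a) = Quotient.mk s (f a') :=
    Quotient.sound ((hs ((hr (hf a)).2 h)).1 (hf a'))
  have hT (a : α) (b : β) :
      Quotient.lift (fun a => Quotient.mk s (f a)) hlift (Quotient.mk r a) = Quotient.mk s b ↔
        R a b :=
    Quotient.eq.trans (hs (hf a)).symm
  refine ⟨_, ⟨?_, ?_⟩, hT⟩
  · rintro ⟨a⟩ ⟨a'⟩ h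
    exact Quotient.sound ((hr (hf a)).1 ((hT a' _).1 h.symm))
  · rintro ⟨b⟩
    obtain ⟨a, hab⟩ := hright b
    exact ⟨Quotient.mk r a, (hT a b).2 hab⟩

theorem IsConvexPotential.hasWeakHessian_iff {Ω : Set Plane} {s s' : Plane → ℝ} {H : Plane → Mat2}
    (hs : IsConvexPotential Ω s) (hs' : IsConvexPotential Ω s') (hΩ : IsOpen Ω)
    (hbounded : Bornology.IsBounded Ω) (h : HasWeakHessian Ω s H) :
    HasWeakHessian Ω s' H ↔ ∃ a : Plane →ᵃ[ℝ] ℝ, ∀ x ∈ Ω, s x - s' x = a x :=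
  ⟨hs.exists_affineMap hs' hΩ hbounded h, fun ⟨_, ha⟩ => h.of_sub_eq_affineMap hΩ ha⟩

theorem HasWeakHessian.rotR_conj_iff_ae_eq {Ω : Set Plane} {s : Plane → ℝ} {Q Q' : Plane → Mat2}
    (hΩ : IsOpen Ω) (h : HasWeakHessian Ω s fun x => rotRᵀ * Q x * rotR) :
    HasWeakHessian Ω s (fun x => rotRᵀ * Q' x * rotR) ↔ Q =ᵐ[volume.restrict Ω] Q' :=
  ⟨fun h' => (h.ae_eq hΩ h').mono fun _ hx => rotR_conj_injective hx,
    fun hQ => h.congr EventuallyEq.rfl (hQ.fun_comp fun M => rotRᵀ * M * rotR)⟩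

theorem mainTheorem2 (Ω : Set Plane) (hopen : IsOpen Ω) (hconvex : Convex ℝ Ω)
    (hbounded : Bornology.IsBounded Ω) :
    (∀ Q : DivFreeField Ω, ∃! S : ConvexClass Ω, ∃ s : ConvexPotential Ω,
      Quotient.mk (convexPotentialSetoid Ω) s = S ∧
        HasWeakHessian Ω s.1 (fun x => rotRᵀ * Q.1 x * rotR)) ∧
    ∃ T : MDiv Ω → ConvexClass Ω, Function.Bijective T ∧
      ∀ (Q : DivFreeField Ω) (s : ConvexPotential Ω),
        T (Quotient.mk (divFreeSetoid Ω) Q) = Quotient.mk (convexPotentialSetoid Ω) s ↔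
          HasWeakHessian Ω s.1 (fun x => rotRᵀ * Q.1 x * rotR) := by
  obtain ⟨T, hbij, hT⟩ := exists_bijective_quotient_of_rel (divFreeSetoid Ω)
    (convexPotentialSetoid Ω)
    (R := fun Q s => HasWeakHessian Ω s.1 fun x => rotRᵀ * Q.1 x * rotR)
    (fun Q => by simpa using Q.2.exists_potential hopen hconvex hbounded)
    (fun s => by simpa using s.2.exists_conductivity hopen)
    (fun h => h.rotR_conj_iff_ae_eq hopen)
    (fun {Q s s'} h => s.2.hasWeakHessian_iff s'.2 hopen hbounded h)
  refine ⟨fun Q => ?_, T, hbij, hT⟩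
  obtain ⟨s, hs⟩ := Quotient.exists_rep (T (Quotient.mk (divFreeSetoid Ω) Q))
  refine ⟨_, ⟨s, hs, (hT Q s).1 hs.symm⟩, ?_⟩
  rintro _ ⟨s', rfl, hs'⟩
  exact ((hT Q s').2 hs').symm
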